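/- There is an absolute constant $c>0$ with the following property. Let $G\subseteq\mathbb C$ be a plane domain, let $N\le\infty$, and let $(\psi_j)_{1\le j\le N}$ be analytic functions in $G$, not all identically zero; if $N=\infty$, assume that the series $\|\Psi(z)\|^2:=\sum_j|\psi_j(z)|^2$ converges locally uniformly in $G$. Let $\omega_1,\omega_2,\dots$ ($N$ of them) be independent standard complex gaussian random variables, i.e. with density $\pi^{-1}e^{-|w|^2}$ on $\mathbb C$, so that $\mathcal E\{\omega_j\}=0$ and $\mathcal E\{|\omega_j|^2\}=1$. Let $\psi(z,\omega)=\sum_j\omega_j\psi_j(z)$ be the associated gaussian analytic function in $G$, and let $n_\omega$ be the counting measure of its zeros in $G$, with multiplicities. Let $\mu=\frac1{2\pi}\Delta\log\|\Psi\|$ (in the sense of distributions) be the Riesz measure in $G$ of the subharmonic function $\log\|\Psi\|$. Then for all concentric open disks $D_r\subset D_R\subseteq G$ of radii $0<r<R$, $$\Pr\bigl(\{\omega:\ n_\omega(D_R)=0\}\bigr)\le 3\exp\Bigl[-c\,\mu(D_r)\,\frac{R-r}{R+r}\Bigr].$$ -/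

import Mathlib

open MeasureTheory ProbabilityTheory Filter
open scoped ENNReal

noncomputable section

/-- The index set `{0, 1, …, N - 1}` of a system of `N ≤ ∞` functions (all of `ℕ` for `N = ∞`). -/
abbrev SysIndex (N : ℕ∞) : Type := {j : ℕ // (j : ℕ∞) < N}

/-- The finite set of the indices smaller than both `n` and `N`. -/
def firstIndices (N : ℕ∞) (n : ℕ) : Finset (SysIndex N) :=
  (Finset.range n).subtype (fun j : ℕ => (j : ℕ∞) < N)

/-- The square norm `‖Ψ(z)‖² = ∑ⱼ |ψⱼ(z)|²` of the holomorphic curve `Ψ = (ψⱼ)ⱼ`. -/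
def curveNormSq {N : ℕ∞} (ψ : SysIndex N → ℂ → ℂ) (z : ℂ) : ℝ :=
  ∑' j, ‖ψ j z‖ ^ 2

/-- The function `log ‖Ψ(z)‖`. Its value at a common zero of the `ψⱼ` is set to `0`, not `-∞`;
in a domain where `Ψ` does not vanish identically these points form a Lebesgue null set. -/
def logCurveNorm {N : ℕ∞} (ψ : SysIndex N → ℂ → ℂ) (z : ℂ) : ℝ :=
  Real.log (Real.sqrt (curveNormSq ψ z))

/-- `ψ` is a system of `N ≤ ∞` analytic functions in `G`, not all identically zero, for which the
series `∑ⱼ |ψⱼ|²` converges locally uniformly in `G` (which holds automatically if `N < ∞`). -/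
structure IsAnalyticSystem {N : ℕ∞} (G : Set ℂ) (ψ : SysIndex N → ℂ → ℂ) : Prop where
  analytic : ∀ j, AnalyticOnNhd ℂ (ψ j) G
  tendsto_normSq : TendstoLocallyUniformlyOn
    (fun (n : ℕ) (z : ℂ) => ∑ j ∈ firstIndices N n, ‖ψ j z‖ ^ 2) (curveNormSq ψ) atTop G
  not_zero : ∃ z ∈ G, ∃ j, ψ j z ≠ 0

/-- The standard complex gaussian law (mean `0`, `E|w|² = 1`), with density `π⁻¹ exp (-|w|²)`. -/
def stdComplexGaussian : Measure ℂ :=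
  volume.withDensity (fun w => ENNReal.ofReal (Real.pi⁻¹ * Real.exp (-‖w‖ ^ 2)))

/-- The gaussian analytic function `ψ(z, ω) = ∑ⱼ ωⱼ ψⱼ(z)`, the series being summed in the order
of the indices; `X j` is the random variable `ω ↦ ωⱼ`. -/
def gaussianAnalyticFunction {N : ℕ∞} {Ω : Type*} (ψ : SysIndex N → ℂ → ℂ)
    (X : SysIndex N → Ω → ℂ) (ω : Ω) (z : ℂ) : ℂ :=
  limUnder atTop (fun n : ℕ => ∑ j ∈ firstIndices N n, X j ω * ψ j z)

/-- The counting measure, with multiplicities, of the zeros in `G` of a function `f` analytic in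
the open set `G`. -/
def zeroCountingMeasure (G : Set ℂ) (f : ℂ → ℂ) : Measure ℂ :=
  Measure.sum (fun z : G => ((analyticOrderAt f (z : ℂ) : ℕ∞) : ℝ≥0∞) • Measure.dirac (z : ℂ))

/-- `μ` is the Riesz measure of `u` in the open set `G`: a measure carried by `G`, finite on the
compact subsets of `G`, that equals `(2π)⁻¹ Δu` in the sense of distributions in `G`. -/
structure IsRieszMeasure (G : Set ℂ) (u : ℂ → ℝ) (μ : Measure ℂ) : Prop where
  locallyIntegrable : LocallyIntegrableOn u G volume
  compl_eq_zero : μ Gᶜ = 0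
  finite_of_isCompact : ∀ K ⊆ G, IsCompact K → μ K < ∞
  integral_eq : ∀ φ : ℂ → ℝ, ContDiff ℝ ((⊤ : ℕ∞) : WithTop ℕ∞) φ → HasCompactSupport φ → tsupport φ ⊆ G →
    ∫ z, φ z ∂μ = (2 * Real.pi)⁻¹ * ∫ z, Laplacian.laplacian φ z * u z

end

/-! Let f = ψ(·, ω), and let φ ≥ 0 be a smooth cutoff supported in a smaller closed disk inside D_R,
with φ ≥ 1 on D_r. If f has no zeros in D_R, then log|f| is harmonic there and integrates to 0
against Δφ (`integral_laplacian_mul_log_norm_eq_zero`). Hence |∫ Δφ (log|f| - log‖Ψ‖)| = 2π ∫ φ dμ ≥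
2π μ(D_r). With A = ∫|Δφ|, a hole therefore forces |log(|f|/‖Ψ‖)| to be at least m = 2π μ(D_r)/A on
average over |Δφ|/A. By Jensen (`ofReal_exp_mul_integral_le_lintegral`) the average of |f|/‖Ψ‖ +
‖Ψ‖/|f| is then at least e^m, while its expectation is at most 3 (`lintegral_ratio_sum_le`).
Markov's inequality gives probability at most 3e^{-m} (`measure_hole_mul_le`), and a radial cutoff
achieves A ≤ K(R+r)/(R-r) (`exists_cutoff_laplacian_le`).

For infinite systems f must first be shown to be almost surely analytic. Cauchy's estimate makes the
partial sums Cauchy in mean for the sup norm on disks, and Ottaviani's inequality upgrades this to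
almost sure locally uniform convergence (`ae_tendstoLocallyUniformlyOn_sum`). The law of the limit
is never computed: Fatou's lemma carries the bound 3 over from finite sums. -/

/-! ### Moments and characteristic function of the standard complex gaussian -/

theorem measurable_gaussianDensity : Measurable fun w : ℂ =>
    ENNReal.ofReal (Real.pi⁻¹ * Real.exp (-‖w‖ ^ 2)) := by
  fun_prop

/-- A Gamma integral; it is used for q = 0 (total mass), q = 1 and q = -1. -/
theorem lintegral_norm_rpow_stdComplexGaussian {q : ℝ} (hq : -2 < q) :
    ∫⁻ w, ENNReal.ofReal (‖w‖ ^ q) ∂stdComplexGaussian =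
      ENNReal.ofReal (Real.Gamma ((q + 2) / 2)) := by
  have hG : 0 < Real.Gamma ((q + 2) / 2) := Real.Gamma_pos_of_pos (by linarith)
  have key := Complex.integral_rpow_mul_exp_neg_rpow (p := 2) (by norm_num) hq
  have hint : Integrable (fun x : ℂ => ‖x‖ ^ q * Real.exp (-‖x‖ ^ (2 : ℝ))) := by
    -- A non-integrable function would have integral 0 by convention, but this integral is positive.
    by_contra h
    rw [integral_undef h] at key
    have : 0 < 2 * Real.pi / 2 * Real.Gamma ((q + 2) / 2) := by positivity
    linarith
  rw [stdComplexGaussian, lintegral_withDensity_eq_lintegral_mul _ measurable_gaussianDensity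
    (by fun_prop)]
  have h1 : ∀ w : ℂ, ((fun w : ℂ => ENNReal.ofReal (Real.pi⁻¹ * Real.exp (-‖w‖ ^ 2))) *
      (fun w : ℂ => ENNReal.ofReal (‖w‖ ^ q)) : ℂ → ℝ≥0∞) w =
      ENNReal.ofReal (Real.pi⁻¹ * (‖w‖ ^ q * Real.exp (-‖w‖ ^ (2 : ℝ)))) := by
    intro w
    simp only [Pi.mul_apply]
    rw [← ENNReal.ofReal_mul (by positivity), Real.rpow_two]
    congr 1
    ring
  rw [lintegral_congr h1, ← ofReal_integral_eq_lintegral_ofReal (hint.const_mul _)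
    (Eventually.of_forall fun w => by positivity), integral_const_mul, key]
  congr 1
  field_simp

instance : IsProbabilityMeasure stdComplexGaussian := by
  constructor
  have := lintegral_norm_rpow_stdComplexGaussian (q := 0) (by norm_num)
  simpa using this

theorem lintegral_enorm_stdComplexGaussian :
    ∫⁻ w, ‖w‖ₑ ∂stdComplexGaussian = ENNReal.ofReal (Real.sqrt Real.pi / 2) := by
  have := lintegral_norm_rpow_stdComplexGaussian (q := 1) (by norm_num)
  simp only [Real.rpow_one, ofReal_norm] at this
  rw [this, show ((1 : ℝ) + 2) / 2 = 1 / 2 + 1 by norm_num, Real.Gamma_add_one (by norm_num),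
    Real.Gamma_one_half_eq]
  congr 1
  ring

theorem lintegral_inv_enorm_stdComplexGaussian :
    ∫⁻ w, ‖w‖ₑ⁻¹ ∂stdComplexGaussian = ENNReal.ofReal (Real.sqrt Real.pi) := by
  have := lintegral_norm_rpow_stdComplexGaussian (q := -1) (by norm_num)
  rw [show ((-1 : ℝ) + 2) / 2 = 1 / 2 by norm_num, Real.Gamma_one_half_eq] at this
  rw [← this]
  apply lintegral_congr_ae
  have h0 : ∀ᵐ w : ℂ ∂stdComplexGaussian, w ≠ 0 :=
    (withDensity_absolutelyContinuous volume _).ae_le (Measure.ae_ne volume 0)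
  filter_upwards [h0] with w hw
  rw [Real.rpow_neg_one, ENNReal.ofReal_inv_of_pos (norm_pos_iff.2 hw), ofReal_norm]

theorem charFun_stdComplexGaussian (t : ℂ) :
    charFun stdComplexGaussian t = Complex.exp (-(‖t‖ ^ 2 / 4 : ℝ)) := by
  rw [charFun_apply, stdComplexGaussian, integral_withDensity_eq_integral_toReal_smul
    measurable_gaussianDensity (by simp)]
  have key := GaussianFourier.integral_cexp_neg_mul_sq_norm_add (V := ℂ) (b := 1) (by simp)
    Complex.I t
  have h1 : ∀ x : ℂ, (ENNReal.ofReal (Real.pi⁻¹ * Real.exp (-‖x‖ ^ 2))).toReal •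
      Complex.exp (inner ℝ x t * Complex.I) = (Real.pi⁻¹ : ℂ) *
      Complex.exp (-1 * ‖x‖ ^ 2 + Complex.I * inner ℝ t x) := by
    intro x
    rw [ENNReal.toReal_ofReal (by positivity), Complex.real_smul, Complex.exp_add,
      real_inner_comm x t]
    push_cast
    rw [mul_comm Complex.I, mul_assoc, neg_one_mul]
  rw [integral_congr_ae (Eventually.of_forall h1), integral_const_mul, key]
  have hpi : (Real.pi : ℂ) ≠ 0 := by exact_mod_cast Real.pi_ne_zero
  simp only [Complex.finrank_real_complex, div_one, Nat.cast_ofNat]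
  rw [div_self two_ne_zero, Complex.cpow_one, ← mul_assoc, inv_mul_cancel₀ hpi, one_mul]
  congr 1
  push_cast
  rw [Complex.I_sq]
  ring

/-! ### Linear combinations of independent gaussians -/

section Sum

variable {ι Ω : Type*} [MeasurableSpace Ω] {P : Measure Ω} [IsProbabilityMeasure P]
  {X : ι → Ω → ℂ}

/-- A linear combination of independent standard complex gaussians is a centered complex
gaussian. -/
theorem map_sum_mul_eq (hX : ∀ j, Measurable (X j)) (hlaw : ∀ j, P.map (X j) = stdComplexGaussian)
    (hind : iIndepFun X P) (s : Finset ι) (a : ι → ℂ) :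
    P.map (fun ω => ∑ j ∈ s, X j ω * a j) =
      stdComplexGaussian.map
        (fun w => (Real.sqrt (∑ j ∈ s, ‖a j‖ ^ 2) : ℂ) * w) := by
  have hm : ∀ j, Measurable fun ω => X j ω * a j := fun j => (hX j).mul_const _
  have : IsProbabilityMeasure (P.map (fun ω => ∑ j ∈ s, X j ω * a j)) :=
    Measure.isProbabilityMeasure_map (by fun_prop)
  have : IsProbabilityMeasure (stdComplexGaussian.map
        (fun w => (Real.sqrt (∑ j ∈ s, ‖a j‖ ^ 2) : ℂ) * w)) :=
    Measure.isProbabilityMeasure_map (by fun_prop)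
  -- Multiplication by a has real adjoint multiplication by its conjugate, so scaling acts on the
  -- argument of the characteristic function, which depends on the modulus only.
  have inner_eq : ∀ x a t : ℂ, inner ℝ (x * a) t = inner ℝ x (starRingEnd ℂ a * t) := by
    intro x a t
    simp [Complex.inner]
    ring
  have hmul : ∀ a t : ℂ, charFun (stdComplexGaussian.map fun w => w * a) t =
      Complex.exp (-(‖a‖ ^ 2 * ‖t‖ ^ 2 / 4 : ℝ)) := by
    intro a t
    rw [charFun_apply, integral_map (by fun_prop) (by fun_prop)]
    simp_rw [inner_eq]
    rw [← charFun_apply, charFun_stdComplexGaussian]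
    simp [mul_pow]
  have hmap : ∀ j, P.map (fun ω => X j ω * a j) = stdComplexGaussian.map fun w => w * a j := by
    intro j
    rw [← hlaw j, Measure.map_map (by fun_prop) (hX j)]
    rfl
  apply Measure.ext_of_charFun
  have hind' : iIndepFun (fun j ω => X j ω * a j) P :=
    hind.comp (fun j w => w * a j) (fun j => by fun_prop)
  rw [iIndepFun.charFun_map_fun_finsetSum_eq_prod (s := s) (X := fun j ω => X j ω * a j)
    (fun j _ => (hm j).aemeasurable)
    (hind'.precomp (g := fun i : s => (i : ι)) Subtype.val_injective)]
  ext t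
  simp_rw [mul_comm (Real.sqrt _ : ℂ)]
  rw [hmul, Finset.prod_apply]
  simp_rw [hmap, hmul]
  rw [← Complex.exp_sum, ← Complex.ofReal_neg]
  congr 1
  simp only [Complex.norm_real, Real.norm_eq_abs, sq_abs]
  rw [Real.sq_sqrt (by positivity), Finset.sum_mul, Finset.sum_div]
  push_cast
  rw [Finset.sum_neg_distrib]

theorem lintegral_enorm_sum (hX : ∀ j, Measurable (X j))
    (hlaw : ∀ j, P.map (X j) = stdComplexGaussian)
    (hind : iIndepFun X P) (s : Finset ι) (a : ι → ℂ) :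
    ∫⁻ ω, ‖∑ j ∈ s, X j ω * a j‖ₑ ∂P =
      ENNReal.ofReal (Real.sqrt (∑ j ∈ s, ‖a j‖ ^ 2)) *
        ENNReal.ofReal (Real.sqrt Real.pi / 2) := by
  rw [← lintegral_map (f := fun w : ℂ => ‖w‖ₑ) (by fun_prop)
    (g := fun ω => ∑ j ∈ s, X j ω * a j) (by fun_prop),
    map_sum_mul_eq hX hlaw hind, lintegral_map (by fun_prop) (by fun_prop)]
  simp_rw [enorm_mul]
  rw [lintegral_const_mul _ (by fun_prop), lintegral_enorm_stdComplexGaussian]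
  congr 1
  rw [← ofReal_norm, Complex.norm_real, Real.norm_of_nonneg (by positivity)]

/-- The mean of `|ξ| + 1 / |ξ|` is at most `3` for a normalized complex gaussian `ξ`. -/
theorem lintegral_ratio_sum_le (hX : ∀ j, Measurable (X j))
    (hlaw : ∀ j, P.map (X j) = stdComplexGaussian)
    (hind : iIndepFun X P) (s : Finset ι) (a : ι → ℂ) :
    ∫⁻ ω, (‖∑ j ∈ s, X j ω * a j‖ₑ / ENNReal.ofReal (Real.sqrt (∑ j ∈ s, ‖a j‖ ^ 2)) +
      ENNReal.ofReal (Real.sqrt (∑ j ∈ s, ‖a j‖ ^ 2)) / ‖∑ j ∈ s, X j ω * a j‖ₑ) ∂P ≤ 3 := by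
  have hσ := map_sum_mul_eq hX hlaw hind s a
  set σ := Real.sqrt (∑ j ∈ s, ‖a j‖ ^ 2) with hσdef
  rw [← lintegral_map (f := fun w : ℂ => ‖w‖ₑ / ENNReal.ofReal σ + ENNReal.ofReal σ / ‖w‖ₑ)
    (by fun_prop) (g := fun ω => ∑ j ∈ s, X j ω * a j) (by fun_prop), hσ,
    lintegral_map (by fun_prop) (by fun_prop)]
  have hσ0 : 0 ≤ σ := Real.sqrt_nonneg _
  have hσe : ‖(σ : ℂ)‖ₑ = ENNReal.ofReal σ := by
    rw [← ofReal_norm, Complex.norm_real, Real.norm_of_nonneg hσ0]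
  -- When σ = 0 both quotients are 0 / 0 = 0 in `ℝ≥0∞`, so no nondegeneracy is needed.
  rcases hσ0.eq_or_lt with h | h
  · simp [← h]
  have hne : ENNReal.ofReal σ ≠ 0 := by simpa using h
  have hnt : ENNReal.ofReal σ ≠ ∞ := by simp
  have h1 : ∀ w : ℂ, ‖(σ : ℂ) * w‖ₑ / ENNReal.ofReal σ + ENNReal.ofReal σ / ‖(σ : ℂ) * w‖ₑ =
      ‖w‖ₑ + ‖w‖ₑ⁻¹ := by
    intro w
    rw [enorm_mul, hσe, mul_comm, ENNReal.mul_div_cancel_right hne hnt, mul_comm, div_eq_mul_inv,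
      ENNReal.mul_inv (Or.inl hne) (Or.inl hnt), ← mul_assoc, ENNReal.mul_inv_cancel hne hnt,
      one_mul]
  simp_rw [h1]
  rw [lintegral_add_left (by fun_prop), lintegral_enorm_stdComplexGaussian,
    lintegral_inv_enorm_stdComplexGaussian, ← ENNReal.ofReal_add (by positivity) (by positivity)]
  -- The mean is √π/2 + √π, so √π ≤ 2 suffices.
  have : Real.sqrt Real.pi ≤ 2 := by
    rw [Real.sqrt_le_left (by norm_num)]
    linarith [Real.pi_le_four]
  calc _ ≤ ENNReal.ofReal 3 := ENNReal.ofReal_le_ofReal (by linarith)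
    _ = 3 := by simp

end Sum

/-! ### Ottaviani's inequality and almost sure convergence -/

section Ottaviani

variable {ι Ω E : Type*} [MeasurableSpace Ω] {P : Measure Ω}
  {X : ι → Ω → ℂ} [NormedAddCommGroup E] [NormedSpace ℂ E]

theorem measurable_norm_sum_smul (hX : ∀ j, Measurable (X j)) (s : Finset ι) (e : ι → E) :
    Measurable fun ω => ‖∑ j ∈ s, X j ω • e j‖ := by
  have h1 : Continuous fun x : s → ℂ => ‖∑ j : s, x j • e j‖ := by fun_prop
  have h2 : Measurable fun ω => fun j : s => X j ω := by fun_prop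
  convert! h1.measurable.comp h2 using 2 with ω
  simp only [Function.comp_apply]
  rw [← Finset.sum_coe_sort s]

/-- **Ottaviani's inequality** for sums of fixed vectors with independent random coefficients. -/
theorem ottaviani_inequality [DecidableEq ι] [IsProbabilityMeasure P] (hX : ∀ j, Measurable (X j)) (hind : iIndepFun X P)
    {T : ℕ → Finset ι} (hT : Monotone T) (e : ι → E) (N : ℕ) (t : ℝ)
    (h : ∀ k ≤ N, P {ω | t < ‖∑ j ∈ T N \ T k, X j ω • e j‖} ≤ 1 / 2) :
    P {ω | ∃ k ≤ N, 2 * t < ‖∑ j ∈ T k, X j ω • e j‖} ≤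
      2 * P {ω | t < ‖∑ j ∈ T N, X j ω • e j‖} := by
  set S : ℕ → Ω → E := fun k ω => ∑ j ∈ T k, X j ω • e j with hS
  have hSm : ∀ k, Measurable fun ω => ‖S k ω‖ := fun k => measurable_norm_sum_smul hX _ _
  -- `A k`: the level 2t is first exceeded at time k; `B k`: the rest of the sum up to N is at most
  -- t. They involve disjoint sets of coefficients, hence are independent, and on both the full sum
  -- exceeds t.
  let A : ℕ → Set Ω := fun k => {ω | 2 * t < ‖S k ω‖ ∧ ∀ l < k, ‖S l ω‖ ≤ 2 * t}
  let B : ℕ → Set Ω := fun k => {ω | ‖∑ j ∈ T N \ T k, X j ω • e j‖ ≤ t}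
  have hAm : ∀ k, MeasurableSet (A k) := by
    intro k
    refine (measurableSet_lt measurable_const (hSm k)).inter ?_
    have : {ω | ∀ l < k, ‖S l ω‖ ≤ 2 * t} = ⋂ l, ⋂ (_ : l < k), {ω | ‖S l ω‖ ≤ 2 * t} := by
      ext; simp
    change MeasurableSet {ω | ∀ l < k, ‖S l ω‖ ≤ 2 * t}
    rw [this]
    exact .iInter fun l => .iInter fun _ => measurableSet_le (hSm l) measurable_const
  have hBm : ∀ k, MeasurableSet (B k) := fun k =>
    measurableSet_le (measurable_norm_sum_smul hX _ _) measurable_const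
  have hB : ∀ k ≤ N, 1 / 2 ≤ P (B k) := by
    intro k hk
    have h1 := h k hk
    have h2 : {ω | t < ‖∑ j ∈ T N \ T k, X j ω • e j‖} = (B k)ᶜ := by
      ext; simp [B]
    rw [h2, prob_compl_eq_one_sub (hBm k)] at h1
    have h3 : (1 : ℝ≥0∞) ≤ 1 / 2 + P (B k) := tsub_le_iff_right.1 h1
    have h4 : (1 : ℝ≥0∞) / 2 + 1 / 2 ≤ 1 / 2 + P (B k) := by rwa [ENNReal.add_halves]
    exact (ENNReal.add_le_add_iff_left (by simp)).1 h4
  have hAB : ∀ k, P (A k ∩ B k) = P (A k) * P (B k) := by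
    intro k
    have hi := hind.indepFun_finset (T k) (T N \ T k) Finset.disjoint_sdiff hX
    let s : ℕ → (T k → ℂ) → E := fun l x =>
      ∑ j : T k, if (j : ι) ∈ T l then x j • e j else 0
    have hs : ∀ l, Continuous (s l) := by
      intro l
      refine continuous_finsetSum _ fun j _ => ?_
      split_ifs <;> fun_prop
    have hsS : ∀ l ≤ k, ∀ ω, s l (fun j => X j ω) = S l ω := by
      intro l hl ω
      simp only [s, S]
      rw [Finset.sum_coe_sort (T k) (fun j => if j ∈ T l then X j ω • e j else 0),
        ← Finset.sum_filter]
      congr 1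
      ext j
      simp only [Finset.mem_filter, and_iff_right_iff_imp]
      exact fun hj => hT hl hj
    let A' : Set (T k → ℂ) := {x | 2 * t < ‖s k x‖ ∧ ∀ l < k, ‖s l x‖ ≤ 2 * t}
    let B' : Set ((T N \ T k : Finset ι) → ℂ) := {x | ‖∑ j, x j • e j‖ ≤ t}
    have hA' : MeasurableSet A' := by
      refine (measurableSet_lt measurable_const (hs k).norm.measurable).inter ?_
      have : {x | ∀ l < k, ‖s l x‖ ≤ 2 * t} = ⋂ l, ⋂ (_ : l < k), {x | ‖s l x‖ ≤ 2 * t} := by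
        ext; simp
      change MeasurableSet {x | ∀ l < k, ‖s l x‖ ≤ 2 * t}
      rw [this]
      exact .iInter fun l => .iInter fun _ =>
        measurableSet_le (hs l).norm.measurable measurable_const
    have hB' : MeasurableSet B' := by
      have : Continuous fun x : (T N \ T k : Finset ι) → ℂ => ‖∑ j, x j • e j‖ := by fun_prop
      exact measurableSet_le this.measurable measurable_const
    have := hi.measure_inter_preimage_eq_mul A' B' hA' hB'
    convert! this using 3
    · ext ω
      simp only [A, A', Set.mem_ofPred_eq, Set.mem_preimage]
      rw [hsS k le_rfl ω]
      have : (∀ l < k, ‖s l fun j => X j ω‖ ≤ 2 * t) ↔ ∀ l < k, ‖S l ω‖ ≤ 2 * t :=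
        forall₂_congr fun l hl => by rw [hsS l hl.le ω]
      rw [this]
    · ext ω
      simp only [B, B', Set.mem_ofPred_eq, Set.mem_preimage]
      rw [Finset.sum_coe_sort (T N \ T k) (fun j => X j ω • e j)]
    · ext ω
      simp only [A, A', Set.mem_ofPred_eq, Set.mem_preimage]
      rw [hsS k le_rfl ω]
      have : (∀ l < k, ‖s l fun j => X j ω‖ ≤ 2 * t) ↔ ∀ l < k, ‖S l ω‖ ≤ 2 * t :=
        forall₂_congr fun l hl => by rw [hsS l hl.le ω]
      rw [this]
    · ext ω
      simp only [B, B', Set.mem_ofPred_eq, Set.mem_preimage]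
      rw [Finset.sum_coe_sort (T N \ T k) (fun j => X j ω • e j)]
  have hdisj : Pairwise fun k l => Disjoint (A k ∩ B k) (A l ∩ B l) := by
    have aux : ∀ k l, k < l → Disjoint (A k ∩ B k) (A l ∩ B l) := by
      intro k l hkl
      rw [Set.disjoint_left]
      rintro ω ⟨h1, -⟩ ⟨h2, -⟩
      exact absurd (h2.2 k hkl) (not_le.2 h1.1)
    intro k l hkl
    rcases lt_or_gt_of_ne hkl with h | h
    · exact aux k l h
    · exact (aux l k h).symm
  have hcover : {ω | ∃ k ≤ N, 2 * t < ‖S k ω‖} ⊆ ⋃ k ∈ Finset.range (N + 1), A k := by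
    rintro ω ⟨k, hk, hω⟩
    have hex : ∃ k, 2 * t < ‖S k ω‖ := ⟨k, hω⟩
    have hle : Nat.find hex ≤ k := Nat.find_min' hex hω
    simp only [Set.mem_iUnion, Finset.mem_range]
    exact ⟨Nat.find hex, by omega, Nat.find_spec hex, fun l hl => not_lt.1 (Nat.find_min hex hl)⟩
  have hsub : ⋃ k ∈ Finset.range (N + 1), (A k ∩ B k) ⊆ {ω | t < ‖S N ω‖} := by
    intro ω hω
    simp only [Set.mem_iUnion, Finset.mem_range] at hω
    obtain ⟨k, hk, h1, h2⟩ := hω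
    have h3 : S N ω = (∑ j ∈ T N \ T k, X j ω • e j) + S k ω :=
      (Finset.sum_sdiff (hT (by omega))).symm
    have h4 : ‖S k ω‖ ≤ ‖S N ω‖ + ‖∑ j ∈ T N \ T k, X j ω • e j‖ := by
      have : S k ω = S N ω - ∑ j ∈ T N \ T k, X j ω • e j := by rw [h3]; abel
      rw [this]
      exact norm_sub_le _ _
    have h5 : 2 * t < ‖S k ω‖ := h1.1
    have h6 : ‖∑ j ∈ T N \ T k, X j ω • e j‖ ≤ t := h2
    change t < ‖S N ω‖
    linarith
  calc P {ω | ∃ k ≤ N, 2 * t < ‖S k ω‖}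
      ≤ P (⋃ k ∈ Finset.range (N + 1), A k) := measure_mono hcover
    _ ≤ ∑ k ∈ Finset.range (N + 1), P (A k) := measure_biUnion_finset_le _ _
    _ ≤ ∑ k ∈ Finset.range (N + 1), 2 * P (A k ∩ B k) := by
        refine Finset.sum_le_sum fun k hk => ?_
        rw [hAB]
        calc P (A k) = 2 * (P (A k) * (1 / 2)) := by
              rw [mul_comm (P (A k)), ← mul_assoc, one_div, ENNReal.mul_inv_cancel (by simp)
                (by simp), one_mul]
          _ ≤ _ := by
              gcongr
              exact hB k (by simpa [Nat.lt_succ_iff] using hk)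
    _ = 2 * P (⋃ k ∈ Finset.range (N + 1), (A k ∩ B k)) := by
        rw [← Finset.mul_sum, measure_biUnion_finset (fun k _ l _ hkl => hdisj hkl)
          (fun k _ => (hAm k).inter (hBm k))]
    _ ≤ _ := by gcongr

/-- A series of fixed vectors with independent random coefficients whose partial sums are Cauchy
in mean has almost surely Cauchy partial sums. -/
theorem ae_cauchySeq_sum_smul [DecidableEq ι] [IsProbabilityMeasure P] (hX : ∀ j, Measurable (X j)) (hind : iIndepFun X P)
    {T : ℕ → Finset ι} (hT : Monotone T) (e : ι → E)
    (h : ∀ ε : ℝ≥0∞, 0 < ε → ∃ m, ∀ n, ∫⁻ ω, ‖∑ j ∈ T n \ T m, X j ω • e j‖ₑ ∂P ≤ ε) :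
    ∀ᵐ ω ∂P, CauchySeq fun n => ∑ j ∈ T n, X j ω • e j := by
  have key : ∀ t : ℝ, 0 < t →
      P {ω | ∀ m, ∃ k, 2 * t < ‖∑ j ∈ T (m + k) \ T m, X j ω • e j‖} = 0 := by
    intro t ht
    have ht0 : ENNReal.ofReal t ≠ 0 := by simpa using ht
    have httop : ENNReal.ofReal t ≠ ∞ := ENNReal.ofReal_ne_top
    refine le_antisymm (ENNReal.le_of_forall_pos_le_add fun δ hδ _ => ?_) bot_le
    rw [zero_add]
    -- The bound δ/2 absorbs the factor 2 in Ottaviani's inequality. The bound 1/4 yields its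
    -- hypothesis 1/2, since an increment after m + k is a difference of two increments after m.
    set η : ℝ≥0∞ := min (δ / 2) (1 / 4) with hη
    have hη0 : 0 < η := lt_min (ENNReal.div_pos (by simpa using hδ.ne') (by simp)) (by simp)
    obtain ⟨m, hm⟩ := h (ENNReal.ofReal t * η) (ENNReal.mul_pos ht0 hη0.ne')
    have hmeas : ∀ s : Finset ι, Measurable fun ω => ‖∑ j ∈ s, X j ω • e j‖ₑ := by
      intro s
      simp_rw [← ofReal_norm]
      exact (measurable_norm_sum_smul hX s e).ennreal_ofReal
    have markov : ∀ (s : Finset ι) (b : ℝ≥0∞), ∫⁻ ω, ‖∑ j ∈ s, X j ω • e j‖ₑ ∂P ≤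
        ENNReal.ofReal t * b → P {ω | t < ‖∑ j ∈ s, X j ω • e j‖} ≤ b := by
      intro s b hs
      have h1 : ENNReal.ofReal t * P {ω | t < ‖∑ j ∈ s, X j ω • e j‖} ≤
          ENNReal.ofReal t * b := by
        refine le_trans ?_ hs
        refine le_trans ?_ (mul_meas_ge_le_lintegral (hmeas s) (ENNReal.ofReal t))
        gcongr
        rename_i ω
        intro hω
        rw [← ofReal_norm]
        exact ENNReal.ofReal_le_ofReal hω.le
      exact (ENNReal.mul_le_mul_iff_right ht0 httop).1 h1
    have hT' : Monotone fun k => T (m + k) \ T m := fun k l hkl =>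
      Finset.sdiff_subset_sdiff (hT (by omega)) le_rfl
    have hincr : ∀ N, ∀ k ≤ N, P {ω | t < ‖∑ j ∈ (T (m + N) \ T m) \ (T (m + k) \ T m),
        X j ω • e j‖} ≤ 1 / 2 := by
      intro N k hk
      refine markov _ _ ?_
      calc ∫⁻ ω, ‖∑ j ∈ (T (m + N) \ T m) \ (T (m + k) \ T m), X j ω • e j‖ₑ ∂P
          ≤ ∫⁻ ω, (‖∑ j ∈ T (m + N) \ T m, X j ω • e j‖ₑ +
            ‖∑ j ∈ T (m + k) \ T m, X j ω • e j‖ₑ) ∂P := by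
            refine lintegral_mono fun ω => ?_
            have := Finset.sum_sdiff (f := fun j => X j ω • e j) (hT' hk)
            rw [← eq_sub_iff_add_eq] at this
            rw [this]
            exact enorm_sub_le
        _ ≤ ENNReal.ofReal t * η + ENNReal.ofReal t * η := by
            rw [lintegral_add_left (hmeas _)]
            exact add_le_add (hm _) (hm _)
        _ ≤ ENNReal.ofReal t * (1 / 2) := by
            rw [← mul_add]
            gcongr
            calc η + η ≤ 1 / 4 + 1 / 4 := add_le_add (min_le_right _ _) (min_le_right _ _)
              _ = 1 / 2 := by
                rw [← ENNReal.toReal_eq_toReal_iff' (by finiteness) (by finiteness)]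
                norm_num [ENNReal.toReal_add]
    have hfin : ∀ N, P {ω | ∃ k ≤ N, 2 * t < ‖∑ j ∈ T (m + k) \ T m, X j ω • e j‖} ≤ δ := by
      intro N
      refine (ottaviani_inequality hX hind hT' e N t (hincr N)).trans ?_
      calc 2 * P {ω | t < ‖∑ j ∈ T (m + N) \ T m, X j ω • e j‖} ≤ 2 * (δ / 2) := by
            gcongr
            exact (markov _ _ (hm _)).trans (min_le_left _ _)
        _ = δ := ENNReal.mul_div_cancel (by simp) (by simp)
    have hmono : Monotone fun N =>
        {ω | ∃ k ≤ N, 2 * t < ‖∑ j ∈ T (m + k) \ T m, X j ω • e j‖} :=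
      fun N N' hN ω ⟨k, hk, h⟩ => ⟨k, hk.trans hN, h⟩
    calc P {ω | ∀ m, ∃ k, 2 * t < ‖∑ j ∈ T (m + k) \ T m, X j ω • e j‖}
        ≤ P (⋃ N, {ω | ∃ k ≤ N, 2 * t < ‖∑ j ∈ T (m + k) \ T m, X j ω • e j‖}) := by
          refine measure_mono fun ω hω => ?_
          obtain ⟨k, hk⟩ := hω m
          exact Set.mem_iUnion.2 ⟨k, k, le_rfl, hk⟩
      _ = ⨆ N, P {ω | ∃ k ≤ N, 2 * t < ‖∑ j ∈ T (m + k) \ T m, X j ω • e j‖} :=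
          hmono.measure_iUnion
      _ ≤ δ := iSup_le hfin
  have hae : ∀ᵐ ω ∂P, ∀ i : ℕ, ∃ m, ∀ k,
      ‖∑ j ∈ T (m + k) \ T m, X j ω • e j‖ ≤ 2 * (1 / ((i : ℝ) + 1)) := by
    rw [ae_all_iff]
    intro i
    rw [ae_iff]
    convert! key (1 / ((i : ℝ) + 1)) (by positivity) using 2
    ext ω
    push Not
    rfl
  filter_upwards [hae] with ω hω
  rw [Metric.cauchySeq_iff']
  intro ε hε
  obtain ⟨i, hi⟩ := exists_nat_one_div_lt (show (0 : ℝ) < ε / 2 by linarith)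
  obtain ⟨m, hm⟩ := hω i
  refine ⟨m, fun n hn => ?_⟩
  obtain ⟨k, rfl⟩ := Nat.exists_eq_add_of_le hn
  rw [dist_eq_norm, ← Finset.sum_sdiff (hT hn), add_sub_cancel_right]
  linarith [hm k]

end Ottaviani

/-! ### Cauchy's estimate by a circle mean -/

open Metric in
/-- Cauchy's estimate of the maximum of a holomorphic function on a disk by its mean over a larger
circle. -/
theorem enorm_le_lintegral_circleMap {f : ℂ → ℂ} {z₀ z : ℂ} {ρ ρ' : ℝ} (hρ : 0 < ρ) (hρ' : ρ < ρ')
    (hf : DiffContOnCl ℂ f (ball z₀ ρ')) (hz : z ∈ closedBall z₀ ρ) :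
    ‖f z‖ₑ ≤ ENNReal.ofReal ((2 * Real.pi)⁻¹ * (ρ' / (ρ' - ρ))) *
      ∫⁻ θ in Set.Ioc 0 (2 * Real.pi), ‖f (circleMap z₀ ρ' θ)‖ₑ := by
  have hρ0 : 0 < ρ' := hρ.trans hρ'
  have hd : 0 < ρ' - ρ := sub_pos.2 hρ'
  have hzb : z ∈ ball z₀ ρ' := closedBall_subset_ball hρ' hz
  rw [← hf.two_pi_i_inv_smul_circleIntegral_sub_inv_smul hzb, enorm_smul, circleIntegral,
    intervalIntegral.integral_of_le (by positivity), ENNReal.ofReal_mul (by positivity),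
    mul_assoc (ENNReal.ofReal _)]
  refine mul_le_mul' (le_of_eq ?_) ?_
  · rw [← ofReal_norm]
    congr 1
    simp [abs_of_pos Real.pi_pos]
  refine (enorm_integral_le_lintegral_enorm _).trans ?_
  rw [← lintegral_const_mul' _ _ ENNReal.ofReal_ne_top]
  refine lintegral_mono fun θ => ?_
  rw [enorm_smul, enorm_smul, ← mul_assoc]
  gcongr
  rw [← enorm_mul, ← ofReal_norm]
  apply ENNReal.ofReal_le_ofReal
  have h1 : ρ' - ρ ≤ ‖circleMap z₀ ρ' θ - z‖ := by
    have h2 : ‖circleMap z₀ ρ' θ - z₀‖ = ρ' := by simp [abs_of_pos hρ0]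
    have h3 : ‖z - z₀‖ ≤ ρ := by simpa [dist_eq_norm] using hz
    have h4 : ‖circleMap z₀ ρ' θ - z₀‖ ≤ ‖circleMap z₀ ρ' θ - z‖ + ‖z - z₀‖ := by
      simpa using norm_add_le (circleMap z₀ ρ' θ - z) (z - z₀)
    linarith
  rw [norm_mul, norm_inv, deriv_circleMap, norm_mul, Complex.norm_I, mul_one, norm_circleMap_zero,
    abs_of_pos hρ0, ← div_eq_mul_inv]
  gcongr

/-! ### Locally uniform convergence of the random series -/

section RandomSeries

variable {ι Ω : Type*} [MeasurableSpace Ω] {P : Measure Ω} [IsProbabilityMeasure P]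
  {X : ι → Ω → ℂ}

open Metric

/-- Cauchy's estimate bounds the sup norm by a mean over a larger circle, and after exchanging
integrals only first moments of gaussians at fixed points remain. Each is √π/2 times a standard
deviation. -/
theorem lintegral_enorm_sum_continuousMap_le (hX : ∀ j, Measurable (X j))
    (hlaw : ∀ j, P.map (X j) = stdComplexGaussian) (hind : iIndepFun X P)
    {ψ : ι → ℂ → ℂ} {z₀ : ℂ} {ρ ρ' : ℝ} (hρ : 0 < ρ) (hρ' : ρ < ρ')
    (hψ : ∀ j, DiffContOnCl ℂ (ψ j) (ball z₀ ρ')) (e : ι → C(closedBall z₀ ρ, ℂ))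
    (he : ∀ j z, e j z = ψ j z) (s : Finset ι) {δ : ℝ}
    (hδ : ∀ z ∈ sphere z₀ ρ', ∑ j ∈ s, ‖ψ j z‖ ^ 2 ≤ δ) :
    ∫⁻ ω, ‖∑ j ∈ s, X j ω • e j‖ₑ ∂P ≤ ENNReal.ofReal (Real.sqrt δ) *
      (ENNReal.ofReal ((2 * Real.pi)⁻¹ * (ρ' / (ρ' - ρ))) *
      (ENNReal.ofReal (Real.sqrt Real.pi / 2) * ENNReal.ofReal (2 * Real.pi))) := by
  have hρ0 : 0 < ρ' := hρ.trans hρ'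
  have hcirc : ∀ θ, circleMap z₀ ρ' θ ∈ sphere z₀ ρ' := circleMap_mem_sphere z₀ hρ0.le
  have hcont : ∀ j, Continuous fun θ => ψ j (circleMap z₀ ρ' θ) := fun j =>
    (hψ j).continuousOn_ball.comp_continuous (continuous_circleMap _ _)
      fun θ => sphere_subset_closedBall (hcirc θ)
  set C := ENNReal.ofReal ((2 * Real.pi)⁻¹ * (ρ' / (ρ' - ρ)))
  have hbound : ∀ ω, ‖∑ j ∈ s, X j ω • e j‖ₑ ≤ C * ∫⁻ θ in Set.Ioc 0 (2 * Real.pi),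
      ‖∑ j ∈ s, X j ω * ψ j (circleMap z₀ ρ' θ)‖ₑ := by
    intro ω
    by_cases htop : C * ∫⁻ θ in Set.Ioc 0 (2 * Real.pi),
      ‖∑ j ∈ s, X j ω * ψ j (circleMap z₀ ρ' θ)‖ₑ = ∞
    · rw [htop]
      exact le_top
    rw [← ofReal_norm, ENNReal.ofReal_le_iff_le_toReal htop,
      ContinuousMap.norm_le _ ENNReal.toReal_nonneg]
    intro z
    rw [← ENNReal.ofReal_le_iff_le_toReal htop, ofReal_norm]
    have hd : DiffContOnCl ℂ (fun z => ∑ j ∈ s, X j ω * ψ j z) (ball z₀ ρ') :=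
      ⟨.fun_sum fun j _ => (hψ j).1.const_mul _,
        continuousOn_finsetSum _ fun j _ => continuousOn_const.mul (hψ j).2⟩
    have := enorm_le_lintegral_circleMap hρ hρ' hd z.2
    convert! this using 2
    simp [ContinuousMap.sum_apply, he]
  refine (lintegral_mono hbound).trans ?_
  rw [lintegral_const_mul' _ _ ENNReal.ofReal_ne_top, lintegral_lintegral_swap]
  · simp_rw [lintegral_enorm_sum hX hlaw hind]
    rw [mul_left_comm]
    gcongr
    calc ∫⁻ θ in Set.Ioc 0 (2 * Real.pi),
          ENNReal.ofReal (Real.sqrt (∑ j ∈ s, ‖ψ j (circleMap z₀ ρ' θ)‖ ^ 2)) *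
            ENNReal.ofReal (Real.sqrt Real.pi / 2)
        ≤ ∫⁻ θ in Set.Ioc 0 (2 * Real.pi), ENNReal.ofReal (Real.sqrt δ) *
            ENNReal.ofReal (Real.sqrt Real.pi / 2) := by
          refine lintegral_mono fun θ => ?_
          gcongr
          exact hδ _ (hcirc θ)
      _ = _ := by
          rw [setLIntegral_const, Real.volume_Ioc, sub_zero, mul_assoc]
  · refine Measurable.aemeasurable ?_
    refine Measurable.enorm (Finset.measurable_fun_sum _ fun j _ => ?_)
    exact ((hX j).comp measurable_fst).mul ((hcont j).measurable.comp measurable_snd)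

/-- The partial sums of a gaussian analytic function converge locally uniformly, almost surely. -/
theorem ae_tendstoLocallyUniformlyOn_sum [DecidableEq ι] (hX : ∀ j, Measurable (X j))
    (hlaw : ∀ j, P.map (X j) = stdComplexGaussian) (hind : iIndepFun X P)
    {T : ℕ → Finset ι} (hT : Monotone T) {ψ : ι → ℂ → ℂ} {V : ℂ → ℝ} {z₀ : ℂ} {R : ℝ}
    (hψ : ∀ j, DifferentiableOn ℂ (ψ j) (ball z₀ R))
    (hV : TendstoLocallyUniformlyOn (fun n z => ∑ j ∈ T n, ‖ψ j z‖ ^ 2) V atTop (ball z₀ R)) :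
    ∀ᵐ ω ∂P, TendstoLocallyUniformlyOn (fun n z => ∑ j ∈ T n, X j ω * ψ j z)
      (fun z => limUnder atTop fun n => ∑ j ∈ T n, X j ω * ψ j z) atTop (ball z₀ R) := by
  have hdisk : ∀ ρ : ℝ, 0 < ρ → ρ < R → ∀ᵐ ω ∂P,
      TendstoUniformlyOn (fun n z => ∑ j ∈ T n, X j ω * ψ j z)
      (fun z => limUnder atTop fun n => ∑ j ∈ T n, X j ω * ψ j z) atTop (closedBall z₀ ρ) := by
    intro ρ hρ hρR
    obtain ⟨ρ', hρ', hρ'R⟩ := exists_between hρR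
    have hψ' : ∀ j, DiffContOnCl ℂ (ψ j) (ball z₀ ρ') := fun j =>
      (hψ j).diffContOnCl_ball (closedBall_subset_ball hρ'R)
    -- As vectors of a Banach space of continuous functions, the restrictions fall under the
    -- abstract convergence theorem.
    let e : ι → C(closedBall z₀ ρ, ℂ) := fun j =>
      ⟨fun z => ψ j z, ((hψ j).continuousOn.mono (closedBall_subset_ball hρR)).domRestrict⟩
    have hVs : TendstoUniformlyOn (fun n z => ∑ j ∈ T n, ‖ψ j z‖ ^ 2) V atTop (sphere z₀ ρ') :=
      (tendstoLocallyUniformlyOn_iff_tendstoUniformlyOn_of_compact (isCompact_sphere _ _)).1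
        (hV.mono ((sphere_subset_closedBall).trans (closedBall_subset_ball hρ'R)))
    have hC := ae_cauchySeq_sum_smul hX hind hT e (by
      intro ε hε
      set K := ENNReal.ofReal ((2 * Real.pi)⁻¹ * (ρ' / (ρ' - ρ))) *
        (ENNReal.ofReal (Real.sqrt Real.pi / 2) * ENNReal.ofReal (2 * Real.pi)) with hK
      obtain ⟨δ, hδ, hδε⟩ := ENNReal.exists_nnreal_pos_mul_lt (a := K) (by finiteness) hε.ne'
      -- Two partial sums within δ²/2 of the limit differ by at most δ², whose square root enters
      -- the mean bound.
      have hδ2 : (0 : ℝ) < δ ^ 2 / 2 := by positivity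
      obtain ⟨m, hm⟩ := eventually_atTop.1 (tendstoUniformlyOn_iff.1 hVs _ hδ2)
      refine ⟨m, fun n => ?_⟩
      refine (lintegral_enorm_sum_continuousMap_le hX hlaw hind hρ hρ' hψ' e (fun _ _ => rfl)
        (T n \ T m) (δ := (δ : ℝ) ^ 2) ?_).trans ?_
      · intro z hz
        rcases le_total n m with hnm | hnm
        · rw [Finset.sdiff_eq_empty_iff_subset.2 (hT hnm)]
          simp
        · have h1 := hm n hnm z hz
          have h2 := hm m le_rfl z hz
          have h3 := Finset.sum_sdiff (f := fun j => ‖ψ j z‖ ^ 2) (hT hnm)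
          rw [Real.dist_eq, abs_lt] at h1 h2
          linarith [h1.1, h1.2, h2.1, h2.2]
      · rw [Real.sqrt_sq δ.coe_nonneg, ENNReal.ofReal_coe_nnreal]
        exact hδε.le)
    filter_upwards [hC] with ω hω
    obtain ⟨g, hg⟩ := cauchySeq_tendsto_of_complete hω
    have hg' := ContinuousMap.tendsto_iff_tendstoUniformly.1 hg
    have hval : ∀ n (z : closedBall z₀ ρ),
        (∑ j ∈ T n, X j ω • e j) z = ∑ j ∈ T n, X j ω * ψ j z := by
      intro n z
      simp only [ContinuousMap.sum_apply, ContinuousMap.smul_apply, smul_eq_mul]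
      rfl
    rw [tendstoUniformlyOn_iff_tendstoUniformly_comp_coe]
    have hlim : ((fun z => limUnder atTop fun n => ∑ j ∈ T n, X j ω * ψ j z) ∘
        ((↑) : closedBall z₀ ρ → ℂ)) = g := by
      ext z
      have := hg'.tendsto_at z
      simp_rw [hval] at this
      exact this.limUnder_eq
    rw [hlim]
    convert! hg' using 2 with n
    ext z
    simp [hval]
  rcases le_or_gt R 0 with hR | hR
  · rw [ball_eq_empty.2 hR]
    exact Eventually.of_forall fun ω U _ z hz => absurd hz (Set.notMem_empty z)
  obtain ⟨u, -, hu, hulim⟩ := exists_seq_strictMono_tendsto' hR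
  have hae := ae_all_iff.2 fun i => hdisk (u i) (hu i).1 (hu i).2
  filter_upwards [hae] with ω hω
  intro U hU z hz
  obtain ⟨i, hi⟩ := ((tendsto_order.1 hulim).1 _ (mem_ball.1 hz)).exists
  exact ⟨closedBall z₀ (u i), mem_nhdsWithin_of_mem_nhds (closedBall_mem_nhds_of_mem hi),
    hω i U hU⟩

end RandomSeries

/-! ### Radial cutoffs -/

section TestFunction

open Metric

/-- The Laplacian of `S (α - β ‖z - z₀‖²)`. -/
theorem laplacian_comp_sub_normSq {S : ℝ → ℝ} (hS : ContDiff ℝ 2 S) (α β : ℝ) (z₀ z : ℂ) :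
    Laplacian.laplacian (fun z : ℂ => S (α - β * ‖z - z₀‖ ^ 2)) z =
      4 * β ^ 2 * ‖z - z₀‖ ^ 2 * deriv (deriv S) (α - β * ‖z - z₀‖ ^ 2) -
        4 * β * deriv S (α - β * ‖z - z₀‖ ^ 2) := by
  set φ : ℂ → ℝ := fun z => S (α - β * ‖z - z₀‖ ^ 2) with hφ
  have hS1 : Differentiable ℝ S := hS.differentiable (by norm_num)
  have hS2 : Differentiable ℝ (deriv S) :=
    (hS.iterate_deriv' 1 1).differentiable (by norm_num)
  have hq : ∀ z : ℂ, HasFDerivAt (fun z : ℂ => α - β * ‖z - z₀‖ ^ 2)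
      (-(β • ((2 : ℕ) • (innerSL ℝ (z - z₀)).comp (ContinuousLinearMap.id ℝ ℂ)))) z := fun z =>
    ((((hasFDerivAt_id z).sub_const z₀).norm_sq).const_mul β).const_sub α
  have hφd : ∀ z, HasFDerivAt φ (deriv S (α - β * ‖z - z₀‖ ^ 2) •
      (-(β • ((2 : ℕ) • (innerSL ℝ (z - z₀)).comp (ContinuousLinearMap.id ℝ ℂ))))) z := fun z =>
    (hS1 _).hasDerivAt.comp_hasFDerivAt z (hq z)
  have hφ2 : ContDiff ℝ 2 φ := by
    apply hS.comp
    exact contDiff_const.sub (contDiff_const.mul ((contDiff_id.sub contDiff_const).norm_sq ℝ))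
  have hfd : Differentiable ℝ (fderiv ℝ φ) :=
    (hφ2.fderiv_right (m := 1) (by norm_num)).differentiable (by norm_num)
  have hsecond : ∀ v, fderiv ℝ (fderiv ℝ φ) z v v =
      4 * β ^ 2 * (inner ℝ (z - z₀) v) ^ 2 * deriv (deriv S) (α - β * ‖z - z₀‖ ^ 2) -
        2 * β * ‖v‖ ^ 2 * deriv S (α - β * ‖z - z₀‖ ^ 2) := by
    intro v
    have h1 : fderiv ℝ (fderiv ℝ φ) z v v = fderiv ℝ (fun y => fderiv ℝ φ y v) z v := by
      rw [fderiv_clm_apply (hfd z) (differentiableAt_const v)]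
      simp
    have h2 : (fun y => fderiv ℝ φ y v) = fun y => deriv S (α - β * ‖y - z₀‖ ^ 2) *
        (-(2 * β) * inner ℝ (y - z₀) v) := by
      ext y
      rw [(hφd y).fderiv]
      simp
      left
      ring
    have h3 := (((hS2 _).hasDerivAt.comp_hasFDerivAt z (hq z)).mul
      ((((hasFDerivAt_id z).sub_const z₀).inner ℝ (hasFDerivAt_const v z)).const_mul
        (-(2 * β)))).fderiv
    rw [h1, h2]
    refine (congrArg (fun L => L v) h3).trans ?_
    simp
    ring
  rw [InnerProductSpace.laplacian_eq_iteratedFDeriv_complexPlane]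
  simp only [iteratedFDeriv_two_apply, Matrix.cons_val_zero, Matrix.cons_val_one]
  rw [hsecond, hsecond]
  have h4 : ‖z - z₀‖ ^ 2 = (inner ℝ (z - z₀) 1) ^ 2 + (inner ℝ (z - z₀) Complex.I) ^ 2 := by
    rw [Complex.sq_norm, Complex.normSq_apply]
    simp [Complex.inner]
    ring
  generalize deriv (deriv S) (α - β * ‖z - z₀‖ ^ 2) = A
  generalize deriv S (α - β * ‖z - z₀‖ ^ 2) = B
  rw [norm_one, Complex.norm_I, h4]
  ring

theorem laplacian_eq_zero_of_eventuallyEq_const {φ : ℂ → ℝ} {z : ℂ} {c : ℝ}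
    (h : φ =ᶠ[nhds z] fun _ => c) : Laplacian.laplacian φ z = 0 := by
  rw [InnerProductSpace.laplacian_congr_nhds h |>.eq_of_nhds, InnerProductSpace.laplacian_const]
  rfl

/-- Smooth cutoff functions between concentric disks whose Laplacian has small total mass. -/
theorem exists_cutoff_laplacian_le : ∃ K : ℝ, 0 < K ∧ ∀ (z₀ : ℂ) (r R : ℝ), 0 < r → r < R →
    ∃ (φ : ℂ → ℝ) (ρ : ℝ), ContDiff ℝ ((⊤ : ℕ∞) : WithTop ℕ∞) φ ∧ 0 < ρ ∧ ρ < R ∧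
      tsupport φ ⊆ closedBall z₀ ρ ∧ (∀ z, 0 ≤ φ z) ∧ (∀ z ∈ ball z₀ r, 1 ≤ φ z) ∧
      ∫ z, |Laplacian.laplacian φ z| ≤ K * ((R + r) / (R - r)) := by
  have hSm : ∀ n : ℕ∞, ContDiff ℝ n Real.smoothTransition := fun n => Real.smoothTransition.contDiff
  have hS2 : ContDiff ℝ 2 Real.smoothTransition := hSm 2
  have hc1 : Continuous (deriv Real.smoothTransition) := hS2.continuous_deriv (by norm_num)
  have hc2 : Continuous (deriv (deriv Real.smoothTransition)) :=
    (hS2.iterate_deriv' 1 1).continuous_deriv le_rfl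
  obtain ⟨M₁, hM₁⟩ := (isCompact_Icc (a := (0 : ℝ)) (b := 1)).exists_bound_of_continuousOn
    hc1.continuousOn
  obtain ⟨M₂, hM₂⟩ := (isCompact_Icc (a := (0 : ℝ)) (b := 1)).exists_bound_of_continuousOn
    hc2.continuousOn
  have hM₁0 : 0 ≤ M₁ := (norm_nonneg _).trans (hM₁ 0 (by simp))
  have hM₂0 : 0 ≤ M₂ := (norm_nonneg _).trans (hM₂ 0 (by simp))
  refine ⟨4 * Real.pi * (M₁ + M₂ + 1), by positivity, fun z₀ r R hr hrR => ?_⟩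
  set a := r ^ 2 with ha
  -- The cutoff is a smooth step of an affine function of |z - z₀|² that equals 1 at radius √a = r
  -- and 0 at radius √b. The midpoint b keeps √b < R while b - a = (R² - r²)/2 stays comparable to
  -- R² - r².
  set b := (r ^ 2 + R ^ 2) / 2 with hb
  have hR : 0 < R := hr.trans hrR
  have hRr : 0 < R - r := sub_pos.2 hrR
  have ha0 : 0 < a := by positivity
  have hb0 : 0 < b := by positivity
  have hbR : b < R ^ 2 := by nlinarith
  have hab : 0 < b - a := by rw [ha, hb]; nlinarith
  set β := (b - a)⁻¹ with hβ
  have hβ0 : 0 < β := inv_pos.2 hab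
  set q : ℂ → ℝ := fun z => b * β - β * ‖z - z₀‖ ^ 2 with hq
  have hq' : ∀ z, q z = (b - ‖z - z₀‖ ^ 2) / (b - a) := fun z => by
    simp only [hq, hβ]
    field_simp
  have hqc : Continuous q := by fun_prop
  have hq0 : ∀ z, q z < 0 ↔ b < ‖z - z₀‖ ^ 2 := fun z => by
    rw [hq', div_neg_iff]
    constructor
    · rintro (h | h) <;> linarith
    · intro h
      right
      constructor <;> linarith
  have hq1 : ∀ z, 1 < q z ↔ ‖z - z₀‖ ^ 2 < a := fun z => by
    rw [hq', one_lt_div hab]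
    constructor <;> intro h <;> linarith
  set φ : ℂ → ℝ := fun z => Real.smoothTransition (q z) with hφ
  have hlap0 : ∀ z, (q z < 0 ∨ 1 < q z) → Laplacian.laplacian φ z = 0 := by
    rintro z (h | h)
    · refine laplacian_eq_zero_of_eventuallyEq_const (c := 0) ?_
      filter_upwards [(isOpen_Iio.preimage hqc).mem_nhds h] with y hy
      exact Real.smoothTransition.zero_of_nonpos (le_of_lt hy)
    · refine laplacian_eq_zero_of_eventuallyEq_const (c := 1) ?_
      filter_upwards [(isOpen_Ioi.preimage hqc).mem_nhds h] with y hy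
      exact Real.smoothTransition.one_of_one_le (le_of_lt hy)
  have hsb : Real.sqrt b < R := by
    rw [Real.sqrt_lt' hR]
    exact hbR
  refine ⟨φ, Real.sqrt b, ?_, Real.sqrt_pos.2 hb0, hsb, ?_,
    fun z => Real.smoothTransition.nonneg _, ?_, ?_⟩
  · exact (hSm ⊤).comp (contDiff_const.sub (contDiff_const.mul
      ((contDiff_id.sub contDiff_const).norm_sq ℝ)))
  · refine closure_minimal (fun z hz => ?_) isClosed_closedBall
    rw [mem_closedBall, dist_eq_norm]
    refine Real.le_sqrt_of_sq_le (not_lt.1 fun h => hz ?_)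
    exact Real.smoothTransition.zero_of_nonpos ((hq0 z).2 h).le
  · intro z hz
    refine (Real.smoothTransition.one_of_one_le ((hq1 z).2 ?_).le).ge
    rw [mem_ball, dist_eq_norm] at hz
    exact pow_lt_pow_left₀ hz (norm_nonneg _) two_ne_zero
  -- The Laplacian lives on an annulus of area π(b - a), where it is at most 4β²bM₂ + 4βM₁ with β =
  -- 1/(b - a).
  · set Ann := closedBall z₀ (Real.sqrt b) \ ball z₀ r with hAnn
    set B := 4 * β ^ 2 * b * M₂ + 4 * β * M₁ with hB
    have hrb : r ≤ Real.sqrt b := Real.le_sqrt_of_sq_le (by linarith)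
    have hvol : volume.real Ann = Real.pi * (b - a) := by
      rw [hAnn, measureReal_sdiff (ball_subset_closedBall.trans (closedBall_subset_closedBall hrb))
        measurableSet_ball (isCompact_closedBall z₀ (Real.sqrt b)).measure_lt_top.ne,
        Measure.real, Measure.real, Complex.volume_closedBall,
        Complex.volume_ball]
      simp only [ENNReal.toReal_mul, ENNReal.toReal_pow, ENNReal.coe_toReal, NNReal.coe_real_pi,
        ENNReal.toReal_ofReal hr.le, ENNReal.toReal_ofReal (Real.sqrt_nonneg b)]
      rw [Real.sq_sqrt hb0.le]
      ring
    have hAm : MeasurableSet Ann := measurableSet_closedBall.diff measurableSet_ball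
    have hpt : ∀ z, |Laplacian.laplacian φ z| ≤ Ann.indicator (fun _ => B) z := by
      intro z
      by_cases hz : z ∈ Ann
      · rw [Set.indicator_of_mem hz]
        have h1 : ‖z - z₀‖ ^ 2 ≤ b := by
          have := hz.1
          rw [mem_closedBall, dist_eq_norm] at this
          exact (Real.le_sqrt (norm_nonneg _) hb0.le).1 this
        have h2 : a ≤ ‖z - z₀‖ ^ 2 := by
          have := hz.2
          rw [mem_ball, dist_eq_norm, not_lt] at this
          exact pow_le_pow_left₀ hr.le this 2
        have hqI : q z ∈ Set.Icc (0 : ℝ) 1 :=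
          ⟨not_lt.1 fun h => absurd ((hq0 z).1 h) (not_lt.2 h1),
            not_lt.1 fun h => absurd ((hq1 z).1 h) (not_lt.2 h2)⟩
        rw [laplacian_comp_sub_normSq hS2]
        refine (abs_sub _ _).trans ?_
        rw [abs_mul (4 * β ^ 2 * ‖z - z₀‖ ^ 2), abs_mul (4 * β), abs_of_nonneg (by positivity : 0 ≤ 4 * β ^ 2 * ‖z - z₀‖ ^ 2),
          abs_of_nonneg (by positivity : 0 ≤ 4 * β)]
        refine add_le_add ?_ (mul_le_mul_of_nonneg_left (hM₁ _ hqI) (by positivity))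
        refine mul_le_mul ?_ (hM₂ _ hqI) (abs_nonneg _) (by positivity)
        gcongr
      · rw [Set.indicator_of_notMem hz, hlap0, abs_zero]
        rw [hq0, hq1]
        by_contra! h
        refine hz ⟨?_, ?_⟩
        · rw [mem_closedBall, dist_eq_norm]
          exact Real.le_sqrt_of_sq_le h.1
        · rw [mem_ball, dist_eq_norm, not_lt]
          exact (pow_le_pow_iff_left₀ hr.le (norm_nonneg _) two_ne_zero).1 h.2
    have hfin : volume Ann ≠ ∞ := ((measure_mono Set.sdiff_subset).trans_lt
      (isCompact_closedBall z₀ (Real.sqrt b)).measure_lt_top).ne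
    calc ∫ z, |Laplacian.laplacian φ z| ≤ ∫ z, Ann.indicator (fun _ => B) z := by
          refine integral_mono_of_nonneg (Eventually.of_forall fun z => abs_nonneg _) ?_
            (Eventually.of_forall hpt)
          exact (integrableOn_const hfin).integrable_indicator hAm
      _ = Real.pi * (b - a) * B := by
          rw [integral_indicator hAm, setIntegral_const, hvol, smul_eq_mul]
      _ = 4 * Real.pi * (M₁ + b * β * M₂) := by
          have : (b - a) * β = 1 := mul_inv_cancel₀ hab.ne'
          rw [hB]
          linear_combination (Real.pi * (4 * β * b * M₂ + 4 * M₁)) * this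
      _ ≤ 4 * Real.pi * (M₁ + M₂ + 1) * ((R + r) / (R - r)) := by
          have h1 : 1 ≤ (R + r) / (R - r) := by
            rw [one_le_div hRr]
            linarith
          -- Here bβ = (R² + r²)/(R² - r²), and R² + r² ≤ (R + r)².
          have h2 : b * β ≤ (R + r) / (R - r) := by
            rw [hβ, ← div_eq_mul_inv, div_le_div_iff₀ hab hRr, hb, ha]
            nlinarith [mul_pos (mul_pos hr hR) hRr]
          rw [mul_assoc (4 * Real.pi)]
          refine mul_le_mul_of_nonneg_left ?_ (by positivity)
          nlinarith [mul_le_mul_of_nonneg_left h1 hM₁0, mul_le_mul_of_nonneg_left h2 hM₂0]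

end TestFunction

/-! ### Green's identity for log|f| -/

section Green

open Metric

theorem laplacian_eq_zero_of_notMem_tsupport {φ : ℂ → ℝ} {z : ℂ} (hz : z ∉ tsupport φ) :
    Laplacian.laplacian φ z = 0 :=
  laplacian_eq_zero_of_eventuallyEq_const (c := 0) (notMem_tsupport_iff_eventuallyEq.1 hz)

theorem contDiffAt_log_norm {f : ℂ → ℂ} {z : ℂ} (hf : AnalyticAt ℂ f z) (h0 : f z ≠ 0)
    (n : ℕ∞) : ContDiffAt ℝ n (fun z => Real.log ‖f z‖) z :=
  ((hf.contDiffAt.restrict_scalars ℝ).norm ℝ h0).log (norm_ne_zero_iff.2 h0)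

/-- `log |f|` is harmonic in the sense of distributions if `f` is holomorphic without zeros. -/
theorem integral_laplacian_mul_log_norm_eq_zero {φ : ℂ → ℝ} {f : ℂ → ℂ} {z₀ : ℂ} {ρ R : ℝ}
    (hφ : ContDiff ℝ ((⊤ : ℕ∞) : WithTop ℕ∞) φ) (hρ : 0 < ρ) (hρR : ρ < R)
    (hsupp : tsupport φ ⊆ closedBall z₀ ρ) (hf : AnalyticOnNhd ℂ f (ball z₀ R))
    (h0 : ∀ z ∈ ball z₀ R, f z ≠ 0) :
    ∫ z, Laplacian.laplacian φ z * Real.log ‖f z‖ = 0 := by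
  have hφc : HasCompactSupport φ :=
    (isCompact_closedBall z₀ ρ).of_isClosed_subset (isClosed_tsupport φ) hsupp
  obtain ⟨ρ₂, hρ₂, hρ₂R⟩ := exists_between hρR
  obtain ⟨ρ₁, hρ₁, hρ₁₂⟩ := exists_between hρ₂
  -- Multiplying by a bump equal to 1 near the support of φ turns log|f| into a compactly supported
  -- smooth function, so Green's identity for Schwartz functions applies.
  let χ : ContDiffBump z₀ := ⟨ρ₁, ρ₂, hρ.trans hρ₁, hρ₁₂⟩
  have hχ : tsupport χ = closedBall z₀ ρ₂ := χ.tsupport_eq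
  set h : ℂ → ℝ := fun z => χ z * Real.log ‖f z‖ with hh
  have hts : tsupport h ⊆ tsupport χ := tsupport_mul_subset_left
  have hhc : HasCompactSupport h :=
    (isCompact_closedBall z₀ ρ₂).of_isClosed_subset (isClosed_tsupport h) (hχ ▸ hts)
  have hhs : ContDiff ℝ ((⊤ : ℕ∞) : WithTop ℕ∞) h := by
    refine contDiff_iff_contDiffAt.2 fun z => ?_
    by_cases hz : z ∈ tsupport h
    swap
    · exact contDiffAt_const.congr_of_eventuallyEq (notMem_tsupport_iff_eventuallyEq.1 hz)
    have hzb : z ∈ ball z₀ R := closedBall_subset_ball hρ₂R (hχ ▸ hts hz)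
    exact χ.contDiffAt.mul (contDiffAt_log_norm (hf z hzb) (h0 z hzb) _)
  have hnear : ∀ z ∈ closedBall z₀ ρ, h =ᶠ[nhds z] fun z => Real.log ‖f z‖ := by
    intro z hz
    filter_upwards [isOpen_ball.mem_nhds (closedBall_subset_ball hρ₁ hz)] with y hy
    simp only [hh]
    rw [χ.one_of_mem_closedBall (ball_subset_closedBall hy), one_mul]
  have green := SchwartzMap.integral_mul_laplacian_right_eq_left (μ := volume)
    (hφc.toSchwartzMap hφ) (hhc.toSchwartzMap hhs)
  simp only [SchwartzMap.laplacian_apply] at green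
  change ∫ z, φ z * Laplacian.laplacian h z = ∫ z, Laplacian.laplacian φ z * h z at green
  have h1 : ∀ z, Laplacian.laplacian φ z * Real.log ‖f z‖ = Laplacian.laplacian φ z * h z := by
    intro z
    by_cases hz : z ∈ tsupport φ
    · rw [(hnear z (hsupp hz)).eq_of_nhds]
    · rw [laplacian_eq_zero_of_notMem_tsupport hz, zero_mul, zero_mul]
  have h2 : ∀ z, φ z * Laplacian.laplacian h z = 0 := by
    intro z
    by_cases hz : z ∈ tsupport φ
    · have hzb := closedBall_subset_ball hρR (hsupp hz)
      rw [(InnerProductSpace.laplacian_congr_nhds (hnear z (hsupp hz))).eq_of_nhds,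
        ((hf z hzb).harmonicAt_log_norm (h0 z hzb)).2.eq_of_nhds]
      simp
    · rw [image_eq_zero_of_notMem_tsupport hz, zero_mul]
  rw [integral_congr_ae (Eventually.of_forall h1), ← green,
    integral_congr_ae (Eventually.of_forall h2), integral_zero]

end Green

/-! ### Jensen's inequality and other deterministic estimates -/

section Deterministic

open Metric

theorem ofReal_integral_le_lintegral_ofReal {α : Type*} [MeasurableSpace α] {μ : Measure α}
    {g : α → ℝ} (hg : Integrable g μ) :
    ENNReal.ofReal (∫ x, g x ∂μ) ≤ ∫⁻ x, ENNReal.ofReal (g x) ∂μ := by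
  calc ENNReal.ofReal (∫ x, g x ∂μ) ≤ ENNReal.ofReal (∫ x, max (g x) 0 ∂μ) :=
        ENNReal.ofReal_le_ofReal (integral_mono hg hg.pos_part fun x => le_max_left _ _)
    _ = ∫⁻ x, ENNReal.ofReal (max (g x) 0) ∂μ :=
        ofReal_integral_eq_lintegral_ofReal hg.pos_part
          (Eventually.of_forall fun x => le_max_right _ _)
    _ = _ := by simp

/-- A form of Jensen's inequality for the exponential function. -/
theorem ofReal_exp_mul_integral_le_lintegral {α : Type*} [MeasurableSpace α] {μ : Measure α}
    {w L : α → ℝ} {m : ℝ} (hw : Integrable w μ) (hwL : Integrable (fun x => w x * L x) μ)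
    (hm : m * ∫ x, |w x| ∂μ ≤ |∫ x, w x * L x ∂μ|) :
    ENNReal.ofReal (Real.exp m * ∫ x, |w x| ∂μ) ≤
      ∫⁻ x, ENNReal.ofReal (|w x| * Real.exp |L x|) ∂μ := by
  -- Integrate the tangent line bound e^t ≥ e^m(1 + t - m) at t = |L| against |w|. Neither
  -- normalization of |w| nor integrability of exp|L| is needed.
  have hg : Integrable (fun x => Real.exp m * (|w x| * (1 - m) + |w x * L x|)) μ :=
    ((hw.abs.mul_const _).add hwL.abs).const_mul _
  have hint : ∫ x, Real.exp m * (|w x| * (1 - m) + |w x * L x|) ∂μ =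
      Real.exp m * ((∫ x, |w x| ∂μ) * (1 - m) + ∫ x, |w x * L x| ∂μ) := by
    rw [integral_const_mul, integral_add (hw.abs.mul_const _) hwL.abs, integral_mul_const]
  have hle : Real.exp m * ∫ x, |w x| ∂μ ≤
      ∫ x, Real.exp m * (|w x| * (1 - m) + |w x * L x|) ∂μ := by
    rw [hint]
    refine mul_le_mul_of_nonneg_left ?_ (Real.exp_pos m).le
    have := hm.trans (abs_integral_le_integral_abs (f := fun x => w x * L x))
    linarith
  refine (ENNReal.ofReal_le_ofReal hle).trans ((ofReal_integral_le_lintegral_ofReal hg).trans ?_)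
  refine lintegral_mono fun x => ENNReal.ofReal_le_ofReal ?_
  have h1 : Real.exp m * (1 + (|L x| - m)) ≤ Real.exp |L x| := by
    have : Real.exp |L x| = Real.exp m * Real.exp (|L x| - m) := by
      rw [← Real.exp_add]
      congr 1
      ring
    rw [this]
    refine mul_le_mul_of_nonneg_left ?_ (Real.exp_pos m).le
    linarith [Real.add_one_le_exp (|L x| - m)]
  rw [abs_mul]
  calc Real.exp m * (|w x| * (1 - m) + |w x| * |L x|) =
        |w x| * (Real.exp m * (1 + (|L x| - m))) := by ring
    _ ≤ _ := mul_le_mul_of_nonneg_left h1 (abs_nonneg _)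

theorem exp_abs_log_sub_log_le {a b : ℝ} (ha : 0 < a) (hb : 0 < b) :
    Real.exp |Real.log a - Real.log b| ≤ a / b + b / a := by
  rcases abs_cases (Real.log a - Real.log b) with ⟨h, -⟩ | ⟨h, -⟩
  · rw [h, Real.exp_sub, Real.exp_log ha, Real.exp_log hb]
    have : 0 < b / a := by positivity
    linarith
  · rw [h, neg_sub, Real.exp_sub, Real.exp_log ha, Real.exp_log hb]
    have : 0 < a / b := by positivity
    linarith

/-- Analyticity matters: `analyticOrderAt` defaults to 0 where f is not analytic, so a null counting
measure alone would not exclude zeros. -/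
theorem ne_zero_of_zeroCountingMeasure_eq_zero {G U : Set ℂ} {f : ℂ → ℂ} (hU : MeasurableSet U)
    (hUG : U ⊆ G) (hf : AnalyticOnNhd ℂ f U) (h : zeroCountingMeasure G f U = 0) :
    ∀ z ∈ U, f z ≠ 0 := by
  intro z hz
  rw [zeroCountingMeasure, Measure.sum_apply _ hU, ENNReal.tsum_eq_zero] at h
  have h1 := h ⟨z, hUG hz⟩
  simp only [Measure.smul_apply, Measure.dirac_apply' _ hU, Set.indicator_of_mem hz,
    Pi.one_apply, smul_eq_mul, mul_one] at h1
  have h2 : analyticOrderAt f z = 0 := by exact_mod_cast h1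
  exact (hf z hz).analyticOrderAt_eq_zero.1 h2

theorem continuous_laplacian {φ : ℂ → ℝ} (hφ : ContDiff ℝ ((⊤ : ℕ∞) : WithTop ℕ∞) φ) :
    Continuous (Laplacian.laplacian φ) := by
  rw [InnerProductSpace.laplacian_eq_iteratedFDeriv_complexPlane]
  have : Continuous (iteratedFDeriv ℝ 2 φ) :=
    hφ.continuous_iteratedFDeriv (WithTop.coe_le_coe.2 (le_top (a := (2 : ℕ∞))))
  fun_prop

theorem tsupport_laplacian_subset (φ : ℂ → ℝ) :
    tsupport (Laplacian.laplacian φ) ⊆ tsupport φ :=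
  closure_minimal (fun _ hz => by_contra fun h => hz (laplacian_eq_zero_of_notMem_tsupport h))
    (isClosed_tsupport φ)

theorem integrable_mul_of_continuousOn {w v : ℂ → ℝ} {K : Set ℂ} (hK : IsCompact K)
    (hw : Continuous w) (hwK : Function.support w ⊆ K) (hv : LocallyIntegrableOn v K volume) :
    Integrable fun z => w z * v z := by
  have h1 : IntegrableOn (fun z => w z * v z) K :=
    (hv.integrableOn_isCompact hK).continuousOn_mul hw.continuousOn hK
  refine (integrableOn_iff_integrable_of_support_subset fun z hz => hwK fun h => hz ?_).1 h1
  simp [h]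

theorem measureReal_ball_le_integral {μ : Measure ℂ} {φ : ℂ → ℝ} {z₀ : ℂ} {r : ℝ}
    (hφ : Continuous φ) (hφc : HasCompactSupport φ) (hμ : μ (tsupport φ) < ∞)
    (h0 : ∀ z, 0 ≤ φ z) (h1 : ∀ z ∈ ball z₀ r, 1 ≤ φ z) :
    μ.real (ball z₀ r) ≤ ∫ z, φ z ∂μ := by
  obtain ⟨C, hC⟩ := hφ.bounded_above_of_compact_support hφc
  have hint : Integrable φ μ := by
    refine (integrableOn_iff_integrable_of_support_subset (subset_tsupport φ)).1 ?_
    exact Measure.integrableOn_of_bounded hμ.ne hφ.aestronglyMeasurable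
      (Eventually.of_forall hC)
  have hb : μ (ball z₀ r) ≠ ∞ := by
    refine ((measure_mono fun z hz => subset_tsupport φ ?_).trans_lt hμ).ne
    have := h1 z hz
    exact (by linarith : (0 : ℝ) < φ z).ne'
  rw [← integral_indicator_one measurableSet_ball]
  refine integral_mono ((integrableOn_const hb).integrable_indicator measurableSet_ball) hint ?_
  intro z
  by_cases hz : z ∈ ball z₀ r
  · simpa [Set.indicator_of_mem hz] using h1 z hz
  · simpa [Set.indicator_of_notMem hz] using h0 z

end Deterministic

/-! ### Positivity of ‖Ψ‖ almost everywhere -/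

section Curve

variable {N : ℕ∞} {G : Set ℂ} {ψ : SysIndex N → ℂ → ℂ}

theorem monotone_firstIndices (N : ℕ∞) : Monotone (firstIndices N) := by
  intro m n hmn j
  simp only [firstIndices, Finset.mem_subtype, Finset.mem_range]
  omega

theorem IsAnalyticSystem.tendsto (h : IsAnalyticSystem G ψ) {z : ℂ} (hz : z ∈ G) :
    Tendsto (fun n => ∑ j ∈ firstIndices N n, ‖ψ j z‖ ^ 2) atTop (nhds (curveNormSq ψ z)) :=
  h.tendsto_normSq.tendsto_at hz

theorem IsAnalyticSystem.curveNormSq_pos (h : IsAnalyticSystem G ψ) {z : ℂ} (hz : z ∈ G)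
    {j : SysIndex N} (hj : ψ j z ≠ 0) : 0 < curveNormSq ψ z := by
  have h1 : ‖ψ j z‖ ^ 2 ≤ curveNormSq ψ z := by
    refine ge_of_tendsto (h.tendsto hz) ?_
    filter_upwards [eventually_gt_atTop (j : ℕ)] with n hn
    refine Finset.single_le_sum (f := fun j => ‖ψ j z‖ ^ 2) (fun _ _ => by positivity) ?_
    simpa [firstIndices] using hn
  have : 0 < ‖ψ j z‖ ^ 2 := by positivity
  linarith

/-- Some component is not identically zero on the connected set G, so its zeros are discrete, hence
null. The default value of `logCurveNorm` at common zeros is thus harmless. -/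
theorem IsAnalyticSystem.ae_curveNormSq_pos (h : IsAnalyticSystem G ψ) (hG : IsOpen G)
    (hGc : IsConnected G) : ∀ᵐ z : ℂ, z ∈ G → 0 < curveNormSq ψ z := by
  obtain ⟨z₁, hz₁, j, hj⟩ := h.not_zero
  have h1 := (h.analytic j).preimage_zero_mem_codiscreteWithin hj hz₁ hGc
  have h2 := ae_restrict_le_codiscreteWithin (μ := volume) hG.measurableSet h1
  have h3 : ∀ᵐ z : ℂ ∂(volume.restrict G), ψ j z ≠ 0 := h2
  rw [ae_restrict_iff' hG.measurableSet] at h3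
  filter_upwards [h3] with z hz hzG
  exact h.curveNormSq_pos hzG (hz hzG)

end Curve

/-! ### The probabilistic estimate for a fixed test function -/

section HoleProbability

open Metric

variable {Ω : Type*} [MeasurableSpace Ω] {P : Measure Ω} [IsProbabilityMeasure P]

/-- The ratio `|S| / σ + σ / |S|` for the sum `S = ∑ xⱼ aⱼ` and `σ² = ∑ |aⱼ|²`. -/
noncomputable def ratioSum {ι : Type*} (s : Finset ι) (x a : ι → ℂ) : ℝ≥0∞ :=
  ‖∑ j ∈ s, x j * a j‖ₑ / ENNReal.ofReal (Real.sqrt (∑ j ∈ s, ‖a j‖ ^ 2)) +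
    ENNReal.ofReal (Real.sqrt (∑ j ∈ s, ‖a j‖ ^ 2)) / ‖∑ j ∈ s, x j * a j‖ₑ

theorem measurable_ratioSum {ι : Type*} {X : ι → Ω → ℂ} (hX : ∀ j, Measurable (X j))
    (s : Finset ι) {ψ : ι → ℂ → ℂ} (hψ : ∀ j, Measurable (ψ j)) :
    Measurable fun p : Ω × ℂ => ratioSum s (fun j => X j p.1) (fun j => ψ j p.2) := by
  have h1 : Measurable fun p : Ω × ℂ => ∑ j ∈ s, X j p.1 * ψ j p.2 :=
    Finset.measurable_fun_sum _ fun j _ =>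
      ((hX j).comp measurable_fst).mul ((hψ j).comp measurable_snd)
  have h2 : Measurable fun p : Ω × ℂ => ∑ j ∈ s, ‖ψ j p.2‖ ^ 2 :=
    Finset.measurable_fun_sum _ fun j _ => (((hψ j).comp measurable_snd).norm.pow_const 2)
  have h3 := h2.sqrt.ennreal_ofReal
  exact (h1.enorm.div h3).add (h3.div h1.enorm)

/-- The mean of `|ξ| + 1 / |ξ|` is at most `3` for the limit of a series of gaussian functions
divided by its standard deviation, also after averaging over the points. -/
theorem lintegral_lintegral_liminf_ratioSum_le {ι : Type*} {X : ι → Ω → ℂ}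
    (hX : ∀ j, Measurable (X j)) (hlaw : ∀ j, P.map (X j) = stdComplexGaussian)
    (hind : iIndepFun X P) (T : ℕ → Finset ι) {ψ : ι → ℂ → ℂ} (hψ : ∀ j, Measurable (ψ j))
    {w : ℂ → ℝ≥0∞} (hw : Measurable w) :
    ∫⁻ ω, ∫⁻ z, w z * liminf (fun n => ratioSum (T n) (fun j => X j ω) (fun j => ψ j z)) atTop
      ∂volume ∂P ≤ 3 * ∫⁻ z, w z := by
  let F : ℕ → Ω × ℂ → ℝ≥0∞ := fun n p => ratioSum (T n) (fun j => X j p.1) (fun j => ψ j p.2)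
  have hF : ∀ n, Measurable (F n) := fun n => measurable_ratioSum hX (T n) hψ
  change ∫⁻ ω, ∫⁻ z, w z * liminf (fun n => F n (ω, z)) atTop ∂volume ∂P ≤ _
  rw [lintegral_lintegral_swap]
  · rw [← lintegral_const_mul _ hw]
    refine lintegral_mono fun z => ?_
    have hFz : ∀ n, Measurable fun ω => F n (ω, z) := fun n =>
      (hF n).comp measurable_prodMk_right
    rw [lintegral_const_mul _ (Measurable.liminf hFz), mul_comm]
    gcongr
    -- Fatou's lemma reduces the limit to finite sums.
    refine (lintegral_liminf_le hFz).trans ?_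
    refine (liminf_le_liminf (v := fun _ => (3 : ℝ≥0∞)) (Eventually.of_forall fun n => ?_)).trans
      (liminf_const _).le
    exact lintegral_ratio_sum_le hX hlaw hind (T n) fun j => ψ j z
  · exact ((hw.comp measurable_snd).mul (Measurable.liminf hF)).aemeasurable

theorem liminf_ratio_eq {S : ℕ → ℂ} {v : ℕ → ℝ} {s : ℂ} {V : ℝ} (hS : Tendsto S atTop (nhds s))
    (hv : Tendsto v atTop (nhds V)) (hs : s ≠ 0) (hV : 0 < V) :
    liminf (fun n => ‖S n‖ₑ / ENNReal.ofReal (Real.sqrt (v n)) +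
      ENNReal.ofReal (Real.sqrt (v n)) / ‖S n‖ₑ) atTop =
      ENNReal.ofReal (‖s‖ / Real.sqrt V + Real.sqrt V / ‖s‖) := by
  have h1 : Tendsto (fun n => ‖S n‖ₑ) atTop (nhds ‖s‖ₑ) := (continuous_enorm.tendsto s).comp hS
  have h2 : Tendsto (fun n => ENNReal.ofReal (Real.sqrt (v n))) atTop
      (nhds (ENNReal.ofReal (Real.sqrt V))) :=
    ENNReal.tendsto_ofReal ((Real.continuous_sqrt.tendsto V).comp hv)
  have hs0 : ‖s‖ₑ ≠ 0 := by simpa using hs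
  have hV0 : ENNReal.ofReal (Real.sqrt V) ≠ 0 := by simpa using hV
  have h3 := ((ENNReal.Tendsto.div h1 (Or.inl hs0) h2 (Or.inl (by simp))).add
    (ENNReal.Tendsto.div h2 (Or.inl hV0) h1 (Or.inl (by simp)))).liminf_eq
  have hsn : 0 < ‖s‖ := norm_pos_iff.2 hs
  have hVs : 0 < Real.sqrt V := Real.sqrt_pos.2 hV
  rw [h3, ENNReal.ofReal_add (by positivity) (by positivity), ENNReal.ofReal_div_of_pos hVs,
    ENNReal.ofReal_div_of_pos hsn, ofReal_norm]

/-- The hole probability in terms of a test function. -/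
theorem measure_hole_mul_le {N : ℕ∞} {G : Set ℂ} (hG : IsOpen G) (hGc : IsConnected G)
    {ψ : SysIndex N → ℂ → ℂ} (hsys : IsAnalyticSystem G ψ) {X : SysIndex N → Ω → ℂ}
    (hX : ∀ j, Measurable (X j)) (hlaw : ∀ j, P.map (X j) = stdComplexGaussian)
    (hind : iIndepFun X P) {z₀ : ℂ} {ρ R : ℝ} (hρ : 0 < ρ) (hρR : ρ < R) (hRG : ball z₀ R ⊆ G)
    (hu : LocallyIntegrableOn (logCurveNorm ψ) G volume) {φ : ℂ → ℝ}
    (hφ : ContDiff ℝ ((⊤ : ℕ∞) : WithTop ℕ∞) φ) (hsupp : tsupport φ ⊆ closedBall z₀ ρ) {m : ℝ}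
    (hm : m * ∫ z, |Laplacian.laplacian φ z| ≤
      |∫ z, Laplacian.laplacian φ z * logCurveNorm ψ z|) :
    P {ω | zeroCountingMeasure G (gaussianAnalyticFunction ψ X ω) (ball z₀ R) = 0} *
        ENNReal.ofReal (Real.exp m * ∫ z, |Laplacian.laplacian φ z|) ≤
      3 * ENNReal.ofReal (∫ z, |Laplacian.laplacian φ z|) := by
  classical
  have hK : IsCompact (closedBall z₀ ρ) := isCompact_closedBall z₀ ρ
  have hKR : closedBall z₀ ρ ⊆ ball z₀ R := closedBall_subset_ball hρR
  set w := Laplacian.laplacian φ with hw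
  have hwc : Continuous w := continuous_laplacian hφ
  have hwK : Function.support w ⊆ closedBall z₀ ρ :=
    (subset_tsupport w).trans ((tsupport_laplacian_subset φ).trans hsupp)
  have hwi : Integrable w := hwc.integrable_of_hasCompactSupport
    (hK.of_isClosed_subset (isClosed_tsupport w) ((tsupport_laplacian_subset φ).trans hsupp))
  have hψd : ∀ j, DifferentiableOn ℂ (ψ j) (ball z₀ R) := fun j =>
    ((hsys.analytic j).mono hRG).differentiableOn
  -- Extension by zero gives functions measurable on all of ℂ, as Tonelli's theorem requires; w
  -- vanishes off the disk.
  let ψ' : SysIndex N → ℂ → ℂ := fun j => (ball z₀ R).piecewise (ψ j) 0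
  have hψ' : ∀ j, Measurable (ψ' j) := fun j =>
    (hψd j).continuousOn.measurable_piecewise continuousOn_const measurableSet_ball
  have hψ'eq : ∀ j, ∀ z ∈ ball z₀ R, ψ' j z = ψ j z := fun j z hz =>
    Set.piecewise_eq_of_mem _ _ _ hz
  have hconv := ae_tendstoLocallyUniformlyOn_sum hX hlaw hind (monotone_firstIndices N) hψd
    (hsys.tendsto_normSq.mono hRG)
  -- Measurability of the hole event is avoided: up to a null set it lies in {c ≤ H}, and Markov's
  -- inequality is applied to the measurable H.
  let H : Ω → ℝ≥0∞ := fun ω => ∫⁻ z, ENNReal.ofReal |w z| * liminf (fun n =>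
    ratioSum (firstIndices N n) (fun j => X j ω) (fun j => ψ' j z)) atTop
  have hwm : Measurable fun z => ENNReal.ofReal |w z| := hwc.abs.measurable.ennreal_ofReal
  have hHm : Measurable H :=
    ((hwm.comp measurable_snd).mul (Measurable.liminf fun n =>
      measurable_ratioSum hX (firstIndices N n) hψ')).lintegral_prod_right'
  have hH : ∫⁻ ω, H ω ∂P ≤ 3 * ENNReal.ofReal (∫ z, |w z|) := by
    rw [ofReal_integral_eq_lintegral_ofReal hwi.abs (Eventually.of_forall fun z => abs_nonneg _)]
    exact lintegral_lintegral_liminf_ratioSum_le hX hlaw hind _ hψ' hwm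
  set c := ENNReal.ofReal (Real.exp m * ∫ z, |w z|) with hc
  have hle : ∀ᵐ ω ∂P, ω ∈ {ω | zeroCountingMeasure G (gaussianAnalyticFunction ψ X ω)
      (ball z₀ R) = 0} → c ≤ H ω := by
    filter_upwards [hconv] with ω hω hhole
    set f := gaussianAnalyticFunction ψ X ω with hf
    have hfd : DifferentiableOn ℂ f (ball z₀ R) :=
      hω.differentiableOn (Eventually.of_forall fun n => .fun_sum fun j _ =>
        (hψd j).const_mul _) isOpen_ball
    have hfa : AnalyticOnNhd ℂ f (ball z₀ R) := hfd.analyticOnNhd isOpen_ball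
    have hf0 := ne_zero_of_zeroCountingMeasure_eq_zero measurableSet_ball hRG hfa hhole
    have hlogc : ContinuousOn (fun z => Real.log ‖f z‖) (ball z₀ R) :=
      hfd.continuousOn.norm.log fun z hz => norm_ne_zero_iff.2 (hf0 z hz)
    have hwlog : Integrable fun z => w z * Real.log ‖f z‖ :=
      integrable_mul_of_continuousOn hK hwc hwK
        ((hlogc.mono hKR).locallyIntegrableOn measurableSet_closedBall)
    have hwu : Integrable fun z => w z * logCurveNorm ψ z :=
      integrable_mul_of_continuousOn hK hwc hwK (hu.mono_set (hKR.trans hRG))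
    have hzero : ∫ z, w z * Real.log ‖f z‖ = 0 :=
      integral_laplacian_mul_log_norm_eq_zero hφ hρ hρR hsupp hfa hf0
    have hdiff : ∀ z, w z * (Real.log ‖f z‖ - logCurveNorm ψ z) =
        w z * Real.log ‖f z‖ - w z * logCurveNorm ψ z := fun z => mul_sub _ _ _
    have hwL : Integrable fun z => w z * (Real.log ‖f z‖ - logCurveNorm ψ z) := by
      simp_rw [hdiff]
      exact hwlog.sub hwu
    have hint : ∫ z, w z * (Real.log ‖f z‖ - logCurveNorm ψ z) =
        -∫ z, w z * logCurveNorm ψ z := by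
      simp_rw [hdiff]
      rw [integral_sub hwlog hwu, hzero, zero_sub]
    refine (ofReal_exp_mul_integral_le_lintegral hwi hwL (m := m) ?_).trans ?_
    · rwa [hint, abs_neg]
    refine lintegral_mono_ae ?_
    filter_upwards [hsys.ae_curveNormSq_pos hG hGc] with z hz
    by_cases hzK : z ∈ closedBall z₀ ρ
    · have hzR := hKR hzK
      have hV := hz (hRG hzR)
      have hψz : ∀ j, ψ' j z = ψ j z := fun j => hψ'eq j z hzR
      simp_rw [hψz, ratioSum]
      rw [liminf_ratio_eq (hω.tendsto_at hzR) (hsys.tendsto (hRG hzR)) (hf0 z hzR) hV,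
        ENNReal.ofReal_mul (abs_nonneg _)]
      gcongr
      exact exp_abs_log_sub_log_le (norm_pos_iff.2 (hf0 z hzR)) (Real.sqrt_pos.2 hV)
    · have : w z = 0 := by_contra fun h => hzK (hwK h)
      simp [this]
  calc P {ω | zeroCountingMeasure G (gaussianAnalyticFunction ψ X ω) (ball z₀ R) = 0} * c
      ≤ P {ω | c ≤ H ω} * c := by
        gcongr ?_ * c
        exact measure_mono_ae hle
    _ = c * P {ω | c ≤ H ω} := mul_comm _ _
    _ ≤ ∫⁻ ω, H ω ∂P := mul_meas_ge_le_lintegral hHm c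
    _ ≤ _ := hH

end HoleProbability

/-! ### Passage to almost everywhere measurable variables, and the conclusion -/

theorem gaussianAnalyticFunction_congr {N : ℕ∞} {Ω : Type*} {ψ : SysIndex N → ℂ → ℂ}
    {X Y : SysIndex N → Ω → ℂ} {ω : Ω} (h : ∀ j, X j ω = Y j ω) :
    gaussianAnalyticFunction ψ X ω = gaussianAnalyticFunction ψ Y ω := by
  ext z
  simp only [gaussianAnalyticFunction, h]

/-- The hole probability in terms of a test function, for random variables that are only almost
everywhere measurable. -/
theorem measureReal_hole_le {Ω : Type*} [MeasurableSpace Ω] {P : Measure Ω}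
    [IsProbabilityMeasure P] {N : ℕ∞} {G : Set ℂ} (hG : IsOpen G) (hGc : IsConnected G)
    {ψ : SysIndex N → ℂ → ℂ} (hsys : IsAnalyticSystem G ψ) {X : SysIndex N → Ω → ℂ}
    (hX : ∀ j, HasLaw (X j) stdComplexGaussian P) (hind : iIndepFun X P)
    {z₀ : ℂ} {ρ R : ℝ} (hρ : 0 < ρ) (hρR : ρ < R) (hRG : Metric.ball z₀ R ⊆ G)
    (hu : LocallyIntegrableOn (logCurveNorm ψ) G volume) {φ : ℂ → ℝ}
    (hφ : ContDiff ℝ ((⊤ : ℕ∞) : WithTop ℕ∞) φ) (hsupp : tsupport φ ⊆ Metric.closedBall z₀ ρ)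
    {m : ℝ} (hA : 0 < ∫ z, |Laplacian.laplacian φ z|)
    (hm : m * ∫ z, |Laplacian.laplacian φ z| ≤
      |∫ z, Laplacian.laplacian φ z * logCurveNorm ψ z|) :
    P.real {ω | zeroCountingMeasure G (gaussianAnalyticFunction ψ X ω) (Metric.ball z₀ R) = 0} ≤
      3 * Real.exp (-m) := by
  -- The index set is countable, so almost surely all variables agree with their measurable versions
  -- at once.
  let Y : SysIndex N → Ω → ℂ := fun j => (hX j).aemeasurable.mk (X j)
  have hYm : ∀ j, Measurable (Y j) := fun j => (hX j).aemeasurable.measurable_mk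
  have hXY : ∀ j, X j =ᵐ[P] Y j := fun j => (hX j).aemeasurable.ae_eq_mk
  have hYlaw : ∀ j, P.map (Y j) = stdComplexGaussian := fun j => by
    rw [← (hX j).map_eq, Measure.map_congr (hXY j)]
  have hYind : iIndepFun Y P := hind.congr hXY
  have key := measure_hole_mul_le hG hGc hsys hYm hYlaw hYind hρ hρR hRG hu hφ hsupp hm
  have hset : P {ω | zeroCountingMeasure G (gaussianAnalyticFunction ψ X ω)
        (Metric.ball z₀ R) = 0} =
      P {ω | zeroCountingMeasure G (gaussianAnalyticFunction ψ Y ω) (Metric.ball z₀ R) = 0} := by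
    refine measure_congr ?_
    filter_upwards [ae_all_iff.2 hXY] with ω hω
    have h1 := gaussianAnalyticFunction_congr (ψ := ψ) hω
    change (zeroCountingMeasure G (gaussianAnalyticFunction ψ X ω) (Metric.ball z₀ R) = 0) =
      (zeroCountingMeasure G (gaussianAnalyticFunction ψ Y ω) (Metric.ball z₀ R) = 0)
    rw [h1]
  rw [← hset] at key
  have hreal := ENNReal.toReal_mono (by finiteness) key
  rw [ENNReal.toReal_mul, ENNReal.toReal_mul, ENNReal.toReal_ofReal (by positivity),
    ENNReal.toReal_ofReal hA.le, ENNReal.toReal_ofNat, ← mul_assoc] at hreal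
  rw [Real.exp_neg, ← div_eq_mul_inv, le_div_iff₀ (Real.exp_pos m)]
  exact le_of_mul_le_mul_right hreal hA

theorem corollary1 :
    ∃ c : ℝ, 0 < c ∧
      ∀ (G : Set ℂ), IsOpen G → IsConnected G →
      ∀ (N : ℕ∞) (ψ : SysIndex N → ℂ → ℂ), IsAnalyticSystem G ψ →
      ∀ (Ω : Type*) [MeasurableSpace Ω] (P : Measure Ω) [IsProbabilityMeasure P]
        (X : SysIndex N → Ω → ℂ),
        (∀ j, HasLaw (X j) stdComplexGaussian P) → iIndepFun X P →
      ∀ (μ : Measure ℂ), IsRieszMeasure G (logCurveNorm ψ) μ →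
      ∀ (z₀ : ℂ) (r R : ℝ), 0 < r → r < R → Metric.ball z₀ R ⊆ G →
        P.real {ω | zeroCountingMeasure G (gaussianAnalyticFunction ψ X ω)
            (Metric.ball z₀ R) = 0} ≤
          3 * Real.exp (-(c * μ.real (Metric.ball z₀ r) * ((R - r) / (R + r)))) := by
  obtain ⟨K, hK, hcut⟩ := exists_cutoff_laplacian_le
  -- The factor 2π undoes the normalization of the Riesz measure; K is the cutoff constant.
  refine ⟨2 * Real.pi / K, by positivity, ?_⟩
  intro G hG hGc N ψ hsys Ω _ P _ X hX hind μ hμ z₀ r R hr hrR hRG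
  obtain ⟨φ, ρ, hφ, hρ, hρR, hsupp, hφ0, hφ1, hA⟩ := hcut z₀ r R hr hrR
  have hsR : tsupport φ ⊆ Metric.ball z₀ R := hsupp.trans (Metric.closedBall_subset_ball hρR)
  have hφc : HasCompactSupport φ :=
    (isCompact_closedBall z₀ ρ).of_isClosed_subset (isClosed_tsupport φ) hsupp
  have hmass := measureReal_ball_le_integral hφ.continuous hφc
    (hμ.finite_of_isCompact _ (hsR.trans hRG) hφc) hφ0 hφ1
  rw [hμ.integral_eq φ hφ hφc (hsR.trans hRG)] at hmass
  set M := μ.real (Metric.ball z₀ r) with hM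
  have hM0 : 0 ≤ M := measureReal_nonneg
  set A := ∫ z, |Laplacian.laplacian φ z| with hAdef
  have hA0 : 0 ≤ A := integral_nonneg fun z => abs_nonneg _
  have hRr : 0 < R - r := sub_pos.2 hrR
  have hRr' : 0 < R + r := by linarith
  have hmass' : 2 * Real.pi * M ≤ ∫ z, Laplacian.laplacian φ z * logCurveNorm ψ z := by
    rwa [inv_mul_eq_div, le_div_iff₀' (by positivity)] at hmass
  -- If Δφ vanishes almost everywhere, then the mass of D_r is 0 and the claim reduces to a
  -- probability being at most 3.
  rcases hA0.eq_or_lt with h0 | hApos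
  · have hw0 : Laplacian.laplacian φ =ᵐ[volume] 0 := by
      have hi : Integrable (Laplacian.laplacian φ) :=
        (continuous_laplacian hφ).integrable_of_hasCompactSupport
          (hφc.of_isClosed_subset (isClosed_tsupport _) (tsupport_laplacian_subset φ))
      have := (integral_eq_zero_iff_of_nonneg (fun z => abs_nonneg _) hi.abs).1 h0.symm
      filter_upwards [this] with z hz
      exact abs_eq_zero.1 hz
    have hint : ∫ z, Laplacian.laplacian φ z * logCurveNorm ψ z = 0 := by
      rw [integral_congr_ae (g := fun _ => (0 : ℝ)) (by
        filter_upwards [hw0] with z hz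
        simp [hz]), integral_zero]
    have hM' : M = 0 := by
      rw [hint] at hmass'
      have := Real.pi_pos
      nlinarith
    rw [hM']
    simp only [mul_zero, zero_mul, neg_zero, Real.exp_zero, mul_one]
    exact measureReal_le_one.trans (by norm_num)
  · refine (measureReal_hole_le hG hGc hsys hX hind hρ hρR hRG hμ.locallyIntegrable hφ hsupp
      (m := 2 * Real.pi * M / A) hApos ?_).trans ?_
    · rw [div_mul_cancel₀ _ hApos.ne']
      exact hmass'.trans (le_abs_self _)
    · gcongr
      calc 2 * Real.pi / K * M * ((R - r) / (R + r)) =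
            2 * Real.pi * M / (K * ((R + r) / (R - r))) := by
            field_simp
        _ ≤ 2 * Real.pi * M / A := by gcongr
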